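/- Let $\mathcal X$ be a Polish space, $\rho_{\mathcal X}$ a Borel probability measure on $\mathcal X$ with $\operatorname{supp}\rho_{\mathcal X}=\mathcal X$, and $\mathcal Y$ a separable (real or complex) Hilbert space. Let $K:\mathcal X\times\mathcal X\to\mathcal B(\mathcal Y)$ be a Mercer kernel, that is: $K(x,x')=K(x',x)^*$; $\sum_{i,j=1}^n\langle K(x_i,x_j)y_j,y_i\rangle_{\mathcal Y}\ge 0$ for all $n$, $x_i\in\mathcal X$, $y_i\in\mathcal Y$; and every function in the reproducing kernel Hilbert space $\mathcal H_K$ of $K$ is continuous. Assume that $\int_{\mathcal X}\int_{\mathcal X}\|K(x,x')\|^2\,d\rho_{\mathcal X}(x)\,d\rho_{\mathcal X}(x')\le\kappa^2$ for some real $\kappa$. Let $L_K$ be the integral operator $(L_Kf)(x)=\int_{\mathcal X}K(x,t)f(t)\,d\rho_{\mathcal X}(t)$ on $L^2(\mathcal X,\rho_{\mathcal X};\mathcal Y)$, with norm $\|\cdot\|_{\rho_{\mathcal X}}$; it is bounded, self-adjoint and positive, and its powers are those of the functional calculus. For $\beta\ge 0$ put \[[\mathcal H_K]^\beta:=\{L_K^{\beta/2}f: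 f\in(\ker L_K)^\perp\},\qquad \|L_K^{\beta/2}f\|_{[\mathcal H_K]^\beta}:=\|f\|_{\rho_{\mathcal X}}\quad(f\in(\ker L_K)^\perp).\] For normed spaces $\mathcal G_1,\mathcal G_2$ continuously embedded in a common space, $f\in\mathcal G_1+\mathcal G_2$, $t>0$ and $0<\beta<1$ put \[K(f,t,\mathcal G_1,\mathcal G_2):=\inf\{\|f_1\|_{\mathcal G_1}+t\|f_2\|_{\mathcal G_2}: f=f_1+f_2,\ f_1\in\mathcal G_1,\ f_2\in\mathcal G_2\},\] \[\|f\|_{\beta,2}:=\Big(\int_0^\infty\big(t^{-\beta}K(f,t,\mathcal G_1,\mathcal G_2)\big)^2\,\frac{dt}{t}\Big)^{1/2},\qquad [\mathcal G_1,\mathcal G_2]_{\beta,2}:=\{f\in\mathcal G_1+\mathcal G_2:\|f\|_{\beta,2}<\infty\}.\] Theorem. For every $0<\beta<1$ there are constants $c_\beta,C_\beta>0$, depending only on $\beta$, such that for all $\mathcal X,\rho_{\mathcal X},\mathcal Y,K$ as above \[\operatorname{ran}L_K^{\beta/2}=[\mathcal H_K]^\beta=\big[L^2(\mathcal X,\rho_{\mathcal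 X};\mathcal Y),[\mathcal H_K]^1\big]_{\beta,2},\] the norm of $[\mathcal H_K]^\beta$ is well defined, and, with $\|\cdot\|_{\beta,2}$ the norm of $\big[L^2(\mathcal X,\rho_{\mathcal X};\mathcal Y),[\mathcal H_K]^1\big]_{\beta,2}$, \[c_\beta\|f\|_{\rho_{\mathcal X}}\le\big\|L_K^{\beta/2}f\big\|_{\beta,2}\le C_\beta\|f\|_{\rho_{\mathcal X}}\qquad\text{for all }f\in(\ker L_K)^\perp.\] In particular the norms of the two spaces are equivalent. -/

import Mathlib

/-! ### Powers of positive operators on real or complex Hilbert spaces -/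

section OperatorPower
open Polynomial ContinuousLinearMap
open scoped InnerProductSpace

variable {𝕜 H : Type*} [RCLike 𝕜] [NormedAddCommGroup H] [InnerProductSpace 𝕜 H]

/-- Bounded operators on a real or complex Hilbert space, as a real algebra. -/
noncomputable abbrev operatorRealAlgebra (𝕜 H : Type*) [RCLike 𝕜] [NormedAddCommGroup H]
    [InnerProductSpace 𝕜 H] : NormedAlgebra ℝ (H →L[𝕜] H) :=
  NormedAlgebra.restrictScalars ℝ 𝕜 (H →L[𝕜] H)

attribute [local instance] operatorRealAlgebra

theorem real_smul_operator (r : ℝ) (A : H →L[𝕜] H) : r • A = (r : 𝕜) • A := rfl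

theorem algebraMap_operator (r : ℝ) :
    algebraMap ℝ (H →L[𝕜] H) r = (r : 𝕜) • (1 : H →L[𝕜] H) := by
  rw [Algebra.algebraMap_eq_smul_one, real_smul_operator]

instance operatorIsScalarTower : IsScalarTower ℝ 𝕜 (H →L[𝕜] H) :=
  ⟨fun r c A => by rw [real_smul_operator, smul_smul, RCLike.real_smul_eq_coe_mul]⟩

variable [CompleteSpace H]

theorem isSelfAdjoint_aeval {A : H →L[𝕜] H} (hA : IsSelfAdjoint A) (p : ℝ[X]) :
    IsSelfAdjoint (aeval A p) := by
  induction p using Polynomial.induction_on' with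
  | add p q hp hq => rw [map_add]; exact hp.add hq
  | monomial n a =>
    rw [aeval_monomial, algebraMap_operator, smul_one_mul]
    refine IsSelfAdjoint.smul ?_ (hA.pow n)
    simp [isSelfAdjoint_iff]

/-- A self-adjoint operator has `‖B‖` or `-‖B‖` in its spectrum. -/
theorem norm_or_neg_norm_mem_spectrum [Nontrivial H] {B : H →L[𝕜] H} (hB : IsSelfAdjoint B) :
    ‖B‖ ∈ spectrum ℝ B ∨ -‖B‖ ∈ spectrum ℝ B := by
  by_contra! hcon
  obtain ⟨h1, h2⟩ := hcon
  rw [spectrum.notMem_iff] at h1 h2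
  set M := ‖B‖ with hM
  have hu := h1.mul h2
  have hTx : ∀ x, ((algebraMap ℝ (H →L[𝕜] H) M - B) * (algebraMap ℝ (H →L[𝕜] H) (-M) - B)) x
      = B (B x) - ((M ^ 2 : ℝ) : 𝕜) • x := by
    intro x
    simp only [algebraMap_operator, mul_apply_eq_comp, _root_.sub_apply, _root_.smul_apply,
      one_apply_eq_self, map_sub, map_smul]
    push_cast
    module
  set T := (algebraMap ℝ (H →L[𝕜] H) M - B) * (algebraMap ℝ (H →L[𝕜] H) (-M) - B) with hT
  obtain ⟨u, hu⟩ := hu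
  have hinv : ∀ x, ‖x‖ ≤ ‖(↑u⁻¹ : H →L[𝕜] H)‖ * ‖T x‖ := by
    intro x
    have : x = (↑u⁻¹ : H →L[𝕜] H) (T x) := by
      rw [← hu, ← mul_apply_eq_comp, Units.inv_mul, one_apply_eq_self]
    conv_lhs => rw [this]
    exact ContinuousLinearMap.le_opNorm _ _
  set D := ‖(↑u⁻¹ : H →L[𝕜] H)‖ with hD
  have hM0 : 0 ≤ M := norm_nonneg _
  have hD0 : 0 ≤ D := norm_nonneg _
  have hsa : ∀ x, RCLike.re ⟪B (B x), x⟫_𝕜 = ‖B x‖ ^ 2 := by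
    intro x
    have : ⟪B (B x), x⟫_𝕜 = ⟪B x, B x⟫_𝕜 := by
      have := ContinuousLinearMap.adjoint_inner_left B x (B x)
      rwa [hB.adjoint_eq] at this
    rw [this, inner_self_eq_norm_sq]
  have hTn : ∀ x, ‖T x‖ ^ 2 ≤ M ^ 2 * (M ^ 2 * ‖x‖ ^ 2 - ‖B x‖ ^ 2) := by
    intro x
    rw [hTx, @norm_sub_sq 𝕜, inner_smul_right, RCLike.re_ofReal_mul, hsa, norm_smul,
      RCLike.norm_ofReal, mul_pow, sq_abs]
    have h := ContinuousLinearMap.le_opNorm B (B x)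
    have h' : ‖B (B x)‖ ^ 2 ≤ (M * ‖B x‖) ^ 2 := pow_le_pow_left₀ (norm_nonneg _) h 2
    nlinarith
  have key : ∀ x, ‖x‖ ^ 2 ≤ D ^ 2 * (M ^ 2 * (M ^ 2 * ‖x‖ ^ 2 - ‖B x‖ ^ 2)) := by
    intro x
    calc ‖x‖ ^ 2 ≤ (D * ‖T x‖) ^ 2 := pow_le_pow_left₀ (norm_nonneg _) (hinv x) 2
      _ = D ^ 2 * ‖T x‖ ^ 2 := by ring
      _ ≤ _ := by gcongr; exact hTn x
  obtain ⟨y, hy⟩ := exists_ne (0 : H)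
  have hy' : 0 < ‖y‖ := norm_pos_iff.mpr hy
  have hDM : 0 < D ^ 2 * M ^ 2 := by
    rcases (by positivity : 0 ≤ D ^ 2 * M ^ 2).eq_or_lt with h | h
    · have := key y
      rw [← mul_assoc, ← h] at this
      nlinarith
    · exact h
  have hMpos : 0 < M := by
    rcases hM0.eq_or_lt with h | h
    · rw [← h] at hDM; simp at hDM
    · exact h
  have hDpos : 0 < D := by
    rcases hD0.eq_or_lt with h | h
    · rw [← h] at hDM; simp at hDM
    · exact h
  set c := M ^ 2 - 1 / (D ^ 2 * M ^ 2) with hc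
  have hb : ∀ x, ‖B x‖ ^ 2 ≤ c * ‖x‖ ^ 2 := by
    intro x
    have := key x
    have h3 : ‖x‖ ^ 2 / (D ^ 2 * M ^ 2) ≤ M ^ 2 * ‖x‖ ^ 2 - ‖B x‖ ^ 2 := by
      rw [div_le_iff₀ hDM]; linarith
    rw [hc, sub_mul, one_div_mul_eq_div]
    linarith
  have hc0 : 0 ≤ c := by
    have := hb y
    have h4 := sq_nonneg ‖B y‖
    by_contra h5
    push Not at h5
    have : c * ‖y‖ ^ 2 < 0 := mul_neg_of_neg_of_pos h5 (by positivity)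
    linarith
  have hfin : M ≤ √c := by
    refine ContinuousLinearMap.opNorm_le_bound B (Real.sqrt_nonneg _) fun x => ?_
    rw [← Real.sqrt_sq (norm_nonneg x), ← Real.sqrt_mul hc0]
    exact Real.le_sqrt_of_sq_le (hb x)
  have h6 : M ^ 2 ≤ c := by
    calc M ^ 2 ≤ (√c) ^ 2 := pow_le_pow_left₀ hM0 hfin 2
      _ = c := Real.sq_sqrt hc0
  have : 0 < 1 / (D ^ 2 * M ^ 2) := by positivity
  linarith

/-- If a nonzero real polynomial has no zero on the spectrum of `A`, then `p(A)` is invertible. -/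
theorem isUnit_aeval_of_forall_ne {A : H →L[𝕜] H} (hA : IsSelfAdjoint A) (p : ℝ[X]) :
    p ≠ 0 → (∀ r ∈ spectrum ℝ A, p.eval r ≠ 0) → IsUnit (aeval A p) := by
  induction p using WfDvdMonoid.induction_on_irreducible with
  | zero => intro h; exact absurd rfl h
  | unit u hu => intro _ _; exact hu.map (aeval A)
  | mul a q ha hq ih =>
    intro _ hr
    rw [map_mul]
    refine IsUnit.mul ?_ (ih ha fun r hrr h => hr r hrr (by simp [h]))
    have hr' : ∀ r ∈ spectrum ℝ A, q.eval r ≠ 0 := fun r hrr h => hr r hrr (by simp [h])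
    have hdeg := hq.degree_le_two
    have hq2 : q = C (q.coeff 2) * X ^ 2 + C (q.coeff 1) * X + C (q.coeff 0) :=
      eq_quadratic_of_degree_le_two hdeg
    set α := q.coeff 2
    set β := q.coeff 1
    set γ := q.coeff 0
    by_cases hα : α = 0
    · by_cases hβ : β = 0
      · rw [hα, hβ] at hq2
        have hq3 : q = C γ := by simpa using hq2
        have : γ ≠ 0 := by rintro h; rw [h] at hq3; exact hq.ne_zero (by simpa using hq3)
        exact absurd (hq3 ▸ isUnit_C.mpr this.isUnit) hq.not_isUnit
      · have hnot : -γ / β ∉ spectrum ℝ A := by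
          intro hmem
          refine hr' _ hmem ?_
          rw [hq2, hα]; simp; field_simp; ring
        rw [spectrum.notMem_iff] at hnot
        have hq3 : q = C (-β) * (C (-γ / β) - X) := by
          rw [hq2, hα, mul_sub, ← C_mul, show -β * (-γ / β) = γ by field_simp]
          simp [add_comm]
        rw [hq3, map_mul, map_sub, aeval_C, aeval_C, aeval_X]
        exact ((neg_ne_zero.mpr hβ).isUnit.map (algebraMap ℝ (H →L[𝕜] H))).mul hnot
    · have hroot : ∀ x, q.eval x ≠ 0 := by
        intro x hx
        have h1 := Polynomial.degree_eq_one_of_irreducible_of_root hq hx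
        have : q.coeff 2 = 0 := coeff_eq_zero_of_degree_lt (by rw [h1]; norm_num)
        exact hα this
      have hdis : 0 < 4 * α * γ - β ^ 2 := by
        by_contra h
        push Not at h
        obtain ⟨x, hx⟩ := exists_quadratic_eq_zero (a := α) (b := β) (c := γ) hα
          ⟨√(discrim α β γ), (Real.mul_self_sqrt (by unfold discrim; linarith)).symm⟩
        exact hroot x (by rw [hq2]; simp; linarith)
      set δ := 4 * α * γ - β ^ 2 with hδ
      have hsq : C (4 * α) * q = (C (2 * α) * X + C β) ^ 2 + C δ := by
        rw [hq2, hδ]; simp only [map_sub, map_mul, map_pow, map_ofNat]; ring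
      have hunit : IsUnit (aeval A (C (4 * α) * q)) := by
        rw [hsq]
        set S := aeval A (C (2 * α) * X + C β) with hS
        have hSsa : IsSelfAdjoint S := isSelfAdjoint_aeval hA _
        refine isUnit_of_forall_le_norm_inner_map _ (c := ⟨δ, hdis.le⟩) hdis fun x => ?_
        refine le_trans ?_ (RCLike.re_le_norm _)
        have hx : aeval A ((C (2 * α) * X + C β) ^ 2 + C δ) x = S (S x) + (δ : 𝕜) • x := by
          rw [map_add, map_pow, ← hS, aeval_C, algebraMap_operator, pow_two]
          simp only [_root_.add_apply, mul_apply_eq_comp, _root_.smul_apply, one_apply_eq_self]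
        have : ⟪S (S x), x⟫_𝕜 = ⟪S x, S x⟫_𝕜 := by
          have := ContinuousLinearMap.adjoint_inner_left S x (S x)
          rwa [hSsa.adjoint_eq] at this
        rw [hx, inner_add_left, this, map_add, inner_self_eq_norm_sq, inner_smul_left,
          RCLike.conj_ofReal, RCLike.re_ofReal_mul, inner_self_eq_norm_sq]
        have := sq_nonneg ‖S x‖
        change ‖x‖ ^ 2 * δ ≤ _
        linarith
      rw [map_mul] at hunit
      exact ((((Commute.all (C (4 * α)) q).map (aeval A)).isUnit_mul_iff).mp hunit).2

theorem norm_aeval_eq {A : H →L[𝕜] H} (hA : IsSelfAdjoint A) [CompactSpace (spectrum ℝ A)]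
    (p : ℝ[X]) : ‖aeval A p‖ = ‖toContinuousMapOnAlgHom (spectrum ℝ A) p‖ := by
  rcases subsingleton_or_nontrivial H with hH | hH
  · have : IsEmpty (spectrum ℝ A) := by
      rw [spectrum.of_subsingleton]; infer_instance
    rw [Subsingleton.elim (aeval A p) 0, norm_zero, eq_comm, norm_eq_zero]
    exact ContinuousMap.ext fun x => isEmptyElim x
  · refine le_antisymm ?_ ?_
    · have hmem : ∃ r ∈ spectrum ℝ (aeval A p), |r| = ‖aeval A p‖ := by
        rcases norm_or_neg_norm_mem_spectrum (isSelfAdjoint_aeval hA p) with h | h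
        · exact ⟨_, h, abs_norm _⟩
        · exact ⟨_, h, by rw [abs_neg, abs_norm]⟩
      obtain ⟨r, hr, hrn⟩ := hmem
      by_cases hpr : C r - p = 0
      · obtain ⟨x, hx⟩ : (spectrum ℝ A).Nonempty := by
          rcases norm_or_neg_norm_mem_spectrum hA with h | h <;> exact ⟨_, h⟩
        have := ContinuousMap.norm_coe_le_norm
          (toContinuousMapOnAlgHom (spectrum ℝ A) p) ⟨x, hx⟩
        rw [← sub_eq_zero.mp hpr] at this ⊢
        simp only [toContinuousMapOnAlgHom_apply, toContinuousMapOn_apply,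
          toContinuousMap_apply, eval_C, Real.norm_eq_abs] at this
        rw [← sub_eq_zero.mp hpr] at hrn
        rw [← hrn]; exact this
      · have hex : ∃ x ∈ spectrum ℝ A, (C r - p).eval x = 0 := by
          by_contra! hne
          have hu := isUnit_aeval_of_forall_ne hA _ hpr hne
          rw [map_sub, aeval_C] at hu
          exact hr hu
        obtain ⟨x, hx, hx0⟩ := hex
        have := ContinuousMap.norm_coe_le_norm
          (toContinuousMapOnAlgHom (spectrum ℝ A) p) ⟨x, hx⟩
        simp only [eval_sub, eval_C, sub_eq_zero] at hx0
        simp only [toContinuousMapOnAlgHom_apply, toContinuousMapOn_apply,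
          toContinuousMap_apply, Real.norm_eq_abs, ← hx0, hrn] at this
        exact this
    · rw [ContinuousMap.norm_le _ (norm_nonneg _)]
      rintro ⟨x, hx⟩
      exact spectrum.norm_le_norm_of_mem (spectrum.subset_polynomial_aeval A p ⟨x, hx, rfl⟩)

theorem denseRange_toContinuousMapOnAlgHom (s : Set ℝ) [CompactSpace s] :
    DenseRange (toContinuousMapOnAlgHom (R := ℝ) s) := by
  intro g
  have hg : g ∈ (polynomialFunctions s).topologicalClosure := by
    rw [ContinuousMap.subalgebra_topologicalClosure_eq_top_of_separatesPoints
      (polynomialFunctions s) (polynomialFunctions_separatesPoints _)]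
    trivial
  have : g ∈ closure ((polynomialFunctions s : Set C(s, ℝ))) := hg
  rwa [polynomialFunctions_coe] at this

/-- `p ↦ p(A)` extends to an isometric homomorphism on the continuous functions on the
spectrum. -/
theorem exists_functionalCalculus {A : H →L[𝕜] H} (hA : IsSelfAdjoint A)
    [CompactSpace (spectrum ℝ A)] :
    ∃ φ : C(spectrum ℝ A, ℝ) →⋆ₐ[ℝ] (H →L[𝕜] H), Isometry φ ∧
      ∀ p : ℝ[X], φ (toContinuousMapOnAlgHom (spectrum ℝ A) p) = aeval A p := by
  let i := toContinuousMapOnAlgHom (R := ℝ) (spectrum ℝ A)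
  let f : ℝ[X] →ₐ[ℝ] (H →L[𝕜] H) := aeval A
  let _ : UniformSpace ℝ[X] := UniformSpace.comap i inferInstance
  have hui : IsUniformInducing i.toRingHom := ⟨rfl⟩
  have hdr : DenseRange i := denseRange_toContinuousMapOnAlgHom _
  have hnorm : ∀ p, ‖f p‖ = ‖i p‖ := fun p => norm_aeval_eq hA p
  have huc : UniformContinuous f.toRingHom := by
    rw [((Metric.uniformity_basis_dist (α := C(spectrum ℝ A, ℝ))).comap
      (fun q : ℝ[X] × ℝ[X] => (i q.1, i q.2))).uniformContinuous_iff Metric.uniformity_basis_dist]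
    intro ε hε
    refine ⟨ε, hε, fun p q hpq => ?_⟩
    change dist (i p) (i q) < ε at hpq
    change dist (f p) (f q) < ε
    rwa [dist_eq_norm, ← map_sub, hnorm, map_sub, ← dist_eq_norm]
  let φ := IsDenseInducing.extendRingHom hui hdr huc
  have hφ : ∀ p, φ (i p) = f p := fun p =>
    IsDenseInducing.extend_eq (hui.isDenseInducing hdr) huc.continuous p
  have hφc : Continuous φ := (uniformContinuous_uniformly_extend hui hdr huc).continuous
  have hφn : ∀ g, ‖φ g‖ = ‖g‖ := by
    intro g
    refine hdr.induction_on g (isClosed_eq (by fun_prop) (by fun_prop)) fun p => ?_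
    rw [hφ, hnorm]
  refine ⟨⟨⟨φ, fun r => ?_⟩, fun g => ?_⟩, ?_, hφ⟩
  · have := hφ (C r)
    rwa [show i (C r) = algebraMap ℝ _ r from i.commutes r,
      show f (C r) = algebraMap ℝ _ r from f.commutes r] at this
  · change φ (star g) = star (φ g)
    rw [star_trivial]
    refine hdr.induction_on g (isClosed_eq (by fun_prop) (by fun_prop)) fun p => ?_
    rw [hφ]
    exact (isSelfAdjoint_aeval hA p).star_eq.symm
  · exact AddMonoidHomClass.isometry_of_norm φ hφn

/-- The continuous functional calculus of self-adjoint operators on a real or complex Hilbert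
space. -/
instance operatorContinuousFunctionalCalculus :
    ContinuousFunctionalCalculus ℝ (H →L[𝕜] H) IsSelfAdjoint where
  predicate_zero := .zero _
  compactSpace_spectrum a := isCompact_iff_compactSpace.mp (spectrum.isCompact a)
  spectrum_nonempty a ha := by
    have : Nontrivial H := by
      by_contra h
      rw [not_nontrivial_iff_subsingleton] at h
      exact not_subsingleton (H →L[𝕜] H) inferInstance
    rcases norm_or_neg_norm_mem_spectrum ha with h | h <;> exact ⟨_, h⟩
  exists_cfc_of_predicate A hA := by
    have : CompactSpace (spectrum ℝ A) := isCompact_iff_compactSpace.mp (spectrum.isCompact A)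
    obtain ⟨φ, hφ, hp⟩ := exists_functionalCalculus hA
    have hdr : DenseRange (toContinuousMapOnAlgHom (R := ℝ) (spectrum ℝ A)) :=
      denseRange_toContinuousMapOnAlgHom _
    refine ⟨φ, hφ.continuous, hφ.injective, ?_, fun g => ?_, fun g => ?_⟩
    · have := hp X
      rw [aeval_X] at this
      refine Eq.trans ?_ this
      congr 1
      ext x
      simp
    · refine Set.Subset.antisymm ?_ ?_
      · rw [← ContinuousMap.spectrum_eq_range]
        exact AlgHom.spectrum_apply_subset φ g
      · rintro _ ⟨x, rfl⟩
        change algebraMap ℝ (H →L[𝕜] H) (g x) - φ g ∈ nonunits (H →L[𝕜] H)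
        have := hφ.continuous
        refine hdr.induction_on g (nonunits.isClosed.preimage
          (f := fun g : C(spectrum ℝ A, ℝ) => algebraMap ℝ (H →L[𝕜] H) (g x) - φ g)
          ?_) fun p => ?_
        · simp only [algebraMap_operator]
          have := RCLike.continuous_ofReal (K := 𝕜)
          fun_prop
        · rw [hp]
          exact spectrum.subset_polynomial_aeval A p ⟨x, x.2, rfl⟩
    · change star (φ g) = φ g
      rw [← map_star, star_trivial]

instance operatorStarOrderedRing : StarOrderedRing (H →L[𝕜] H) :=
  ContinuousLinearMap.instStarOrderedRingRCLike

/-- The power `A ^ s` of a positive operator, through the continuous functional calculus. -/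
noncomputable def operatorPow (A : H →L[𝕜] H) (s : ℝ) : H →L[𝕜] H :=
  CFC.rpow A s

end OperatorPower

/-! ### Operator-valued Mercer kernels and their integral operators -/

section Kernel
open MeasureTheory
open scoped InnerProductSpace ENNReal

variable {𝕜 X Y : Type*} [RCLike 𝕜] [NormedAddCommGroup Y] [InnerProductSpace 𝕜 Y]
  [CompleteSpace Y]

/-- An operator-valued kernel: Hermitian symmetric and positive semidefinite. (By Hermitian
symmetry the double sum is real, so that `re` loses nothing.) -/
structure IsOperatorKernel (K : X → X → (Y →L[𝕜] Y)) : Prop where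
  hermitian : ∀ x x', K x x' = ContinuousLinearMap.adjoint (K x' x)
  nonneg : ∀ (n : ℕ) (x : Fin n → X) (y : Fin n → Y),
    0 ≤ RCLike.re (∑ i, ∑ j, ⟪K (x i) (x j) (y j), y i⟫_𝕜)

theorem IsOperatorKernel.posSemidef {K : X → X → (Y →L[𝕜] Y)} (hK : IsOperatorKernel K) :
    Matrix.PosSemidef (Matrix.of K) := by
  have htfae := (RKHS.posSemidef_tfae (K := Matrix.of K)).out 0 2
  refine htfae.mpr ⟨?_, fun v => ?_⟩
  · exact Matrix.ext fun x x' => (hK.hermitian x x').symm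
  · let e := v.support.equivFin.symm
    have h := hK.nonneg _ (fun i => (e i : X)) (fun i => v (e i))
    rw [Finset.sum_comm] at h
    convert h using 2
    rw [Finsupp.sum, ← Finset.sum_coe_sort, ← e.sum_comp]
    refine Finset.sum_congr rfl fun i _ => ?_
    rw [Finsupp.sum, ← Finset.sum_coe_sort, ← e.sum_comp]
    rfl

/-- A kernel is Mercer if its reproducing kernel Hilbert space consists of continuous functions. -/
def IsOperatorKernel.IsMercer [TopologicalSpace X] {K : X → X → (Y →L[𝕜] Y)}
    (hK : IsOperatorKernel K) : Prop :=
  haveI : Fact (Matrix.of K).PosSemidef := ⟨hK.posSemidef⟩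
  ∀ h : RKHS.OfKernel (Matrix.of K), Continuous (fun x => h x)

theorem IsOperatorKernel.IsMercer.continuous_apply [TopologicalSpace X]
    {K : X → X → (Y →L[𝕜] Y)} {hK : IsOperatorKernel K} (hM : hK.IsMercer) (t : X) (y : Y) :
    Continuous fun x => K x t y := by
  have : Fact (Matrix.of K).PosSemidef := ⟨hK.posSemidef⟩
  have h := hM (RKHS.kerFun (RKHS.OfKernel (Matrix.of K)) t y)
  simpa only [RKHS.kerFun_apply, RKHS.OfKernel.kernel_ofKernel, Matrix.of_apply] using h

theorem countable_of_hilbertBasis [TopologicalSpace.SeparableSpace Y] {ι : Type*}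
    (b : HilbertBasis ι 𝕜 Y) : Countable ι := by
  refine Set.countable_univ_iff.mp ?_
  have := b.orthonormal
  refine Set.PairwiseDisjoint.countable_of_isOpen (s := fun i => Metric.ball (b i) (1 / 2))
    (fun i _ j _ hij => ?_) (fun _ _ => Metric.isOpen_ball) (fun i _ => ⟨b i, by simp⟩)
  refine Metric.ball_disjoint_ball ?_
  have h2 : ‖b i - b j‖ ^ 2 = 2 := by
    rw [@norm_sub_sq 𝕜, this.1, this.1, this.2 hij]; norm_num
  rw [dist_eq_norm]
  nlinarith [norm_nonneg (b i - b j)]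

theorem stronglyMeasurable_of_inner [TopologicalSpace.SeparableSpace Y] {α : Type*}
    [MeasurableSpace α] {v : α → Y} (hv : ∀ y : Y, Measurable fun a => ⟪y, v a⟫_𝕜) :
    StronglyMeasurable v := by
  obtain ⟨w, b, -⟩ := exists_hilbertBasis 𝕜 Y
  have := countable_of_hilbertBasis b
  refine stronglyMeasurable_of_tendsto (u := (Filter.atTop : Filter (Finset w)))
    (f := fun s a => ∑ i ∈ s, ⟪b i, v a⟫_𝕜 • b i) (fun s => ?_) ?_
  · exact Finset.stronglyMeasurable_fun_sum _ fun i _ =>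
      (hv (b i)).stronglyMeasurable.smul_const (b i)
  · rw [tendsto_pi_nhds]
    intro a
    have := b.hasSum_repr (v a)
    simpa only [HilbertBasis.repr_apply_apply] using! this

variable [TopologicalSpace X] [PolishSpace X] [MeasurableSpace X] [BorelSpace X]
  [TopologicalSpace.SeparableSpace Y] {K : X → X → (Y →L[𝕜] Y)} {hK : IsOperatorKernel K}

theorem IsOperatorKernel.inner_swap (hK : IsOperatorKernel K) (x t : X) (y y' : Y) :
    ⟪y', K x t y⟫_𝕜 = ⟪K t x y', y⟫_𝕜 := by
  rw [hK.hermitian x t, ContinuousLinearMap.adjoint_inner_right]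

theorem IsOperatorKernel.IsMercer.stronglyMeasurable_apply (hM : hK.IsMercer) (y : Y) :
    StronglyMeasurable fun p : X × X => K p.1 p.2 y := by
  let _ := TopologicalSpace.upgradeIsCompletelyMetrizable X
  refine stronglyMeasurable_uncurry_of_continuous_of_stronglyMeasurable
    (u := fun t x => K t x y) (fun t => hM.continuous_apply t y) fun x => ?_
  refine stronglyMeasurable_of_inner (𝕜 := 𝕜) fun y' => ?_
  simp_rw [hK.inner_swap x _ y y']
  exact (Continuous.inner (hM.continuous_apply x y') continuous_const).measurable

theorem IsOperatorKernel.IsMercer.stronglyMeasurable_comp (hM : hK.IsMercer) {f : X → Y}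
    (hf : StronglyMeasurable f) : StronglyMeasurable fun p : X × X => K p.1 p.2 (f p.2) := by
  borelize Y
  have h : StronglyMeasurable (Function.uncurry fun (y : Y) (p : X × X) => K p.1 p.2 y) :=
    stronglyMeasurable_uncurry_of_continuous_of_stronglyMeasurable
      (fun p => (K p.1 p.2).continuous) fun y => hM.stronglyMeasurable_apply y
  exact h.comp_measurable ((hf.measurable.comp measurable_snd).prodMk measurable_id)

theorem IsOperatorKernel.IsMercer.measurable_enorm (hM : hK.IsMercer) :
    Measurable fun p : X × X => ‖K p.1 p.2‖ₑ := by
  have : Measurable fun p : X × X => ‖K p.1 p.2‖ := by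
    refine measurable_of_Iic fun r => ?_
    rcases lt_or_ge r 0 with hr | hr
    · convert! MeasurableSet.empty
      ext p
      simpa using hr.trans_le (norm_nonneg _)
    · have : (fun p : X × X => ‖K p.1 p.2‖) ⁻¹' Set.Iic r =
          ⋂ n, {p : X × X | ‖K p.1 p.2 (TopologicalSpace.denseSeq Y n)‖ ≤
            r * ‖TopologicalSpace.denseSeq Y n‖} := by
        ext p
        simp only [Set.mem_preimage, Set.mem_Iic, Set.mem_iInter, Set.mem_ofPred_eq]
        refine ⟨fun h n => (K p.1 p.2).le_of_opNorm_le h _, fun h => ?_⟩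
        refine ContinuousLinearMap.opNorm_le_bound _ hr fun y => ?_
        refine (TopologicalSpace.denseRange_denseSeq Y).induction_on y
          (isClosed_le (by fun_prop) (by fun_prop)) h
      rw [this]
      exact MeasurableSet.iInter fun n =>
        measurableSet_le (hM.stronglyMeasurable_apply _).norm.measurable measurable_const
  simpa only [ofReal_norm] using this.ennreal_ofReal

variable {ρX : Measure X} [IsProbabilityMeasure ρX]


theorem IsOperatorKernel.IsMercer.lintegral_enorm_le (hM : hK.IsMercer) (f : Lp Y 2 ρX) (x : X) :
    ∫⁻ t, ‖K x t (f t)‖ₑ ∂ρX ≤ (∫⁻ t, ‖K x t‖ₑ ^ 2 ∂ρX) ^ (1 / 2 : ℝ) * ‖f‖ₑ := by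
  let a : X → ℝ≥0∞ := fun t => ‖K x t‖ₑ
  let b : X → ℝ≥0∞ := fun t => ‖f t‖ₑ
  have ha : Measurable a := by
    have h := hM.measurable_enorm.comp (measurable_prodMk_left (x := x))
    exact h
  have hb : AEMeasurable b ρX := (Lp.aestronglyMeasurable f).enorm
  have h1 : ∫⁻ t, ‖K x t (f t)‖ₑ ∂ρX ≤ ∫⁻ t, (a * b) t ∂ρX :=
    lintegral_mono fun t => ContinuousLinearMap.le_opENorm (K x t) (f t)
  have h2 := ENNReal.lintegral_mul_le_Lp_mul_Lq ρX Real.HolderConjugate.two_two ha.aemeasurable hb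
  refine (h1.trans h2).trans_eq ?_
  rw [Lp.enorm_def, eLpNorm_eq_lintegral_rpow_enorm_toReal (by norm_num) (by norm_num)]
  norm_num [a, b]

/-- The function `x ↦ ∫ K(x, t) f(t) dρ(t)` (Bochner integral). -/
noncomputable def kernelIntegral (K : X → X → (Y →L[𝕜] Y)) (ρX : Measure X) (f : X → Y)
    (x : X) : Y :=
  letI : NormedSpace ℝ Y := NormedSpace.restrictScalars ℝ 𝕜 Y
  ∫ t, K x t (f t) ∂ρX

theorem IsOperatorKernel.IsMercer.eLpNorm_kernelIntegral_le (hM : hK.IsMercer) (f : Lp Y 2 ρX)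
    {κ : ℝ} (hκ : ∫⁻ x, ∫⁻ x', ‖K x x'‖ₑ ^ 2 ∂ρX ∂ρX ≤ ENNReal.ofReal (κ ^ 2)) :
    eLpNorm (kernelIntegral K ρX f) 2 ρX ≤ ENNReal.ofReal |κ| * ‖f‖ₑ := by
  let _ : NormedSpace ℝ Y := NormedSpace.restrictScalars ℝ 𝕜 Y
  rw [eLpNorm_eq_lintegral_rpow_enorm_toReal (by norm_num) (by norm_num)]
  simp only [ENNReal.toReal_ofNat]
  calc (∫⁻ x, ‖kernelIntegral K ρX f x‖ₑ ^ (2 : ℝ) ∂ρX) ^ (1 / 2 : ℝ)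
      ≤ (∫⁻ x, (∫⁻ t, ‖K x t‖ₑ ^ 2 ∂ρX) * ‖f‖ₑ ^ (2 : ℝ) ∂ρX) ^ (1 / 2 : ℝ) := by
        gcongr with x
        calc ‖kernelIntegral K ρX f x‖ₑ ^ (2 : ℝ)
            ≤ ((∫⁻ t, ‖K x t‖ₑ ^ 2 ∂ρX) ^ (1 / 2 : ℝ) * ‖f‖ₑ) ^ (2 : ℝ) := by
              gcongr
              exact (enorm_integral_le_lintegral_enorm _).trans (hM.lintegral_enorm_le f x)
          _ = _ := by
              rw [ENNReal.mul_rpow_of_nonneg _ _ (by norm_num), ← ENNReal.rpow_mul]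
              norm_num
    _ ≤ (ENNReal.ofReal (κ ^ 2) * ‖f‖ₑ ^ (2 : ℝ)) ^ (1 / 2 : ℝ) := by
        rw [lintegral_mul_const' _ _ (by finiteness)]
        gcongr
    _ = _ := by
        rw [ENNReal.mul_rpow_of_nonneg _ _ (by norm_num), ← ENNReal.rpow_mul, ← sq_abs,
          ENNReal.ofReal_pow (abs_nonneg _), ← ENNReal.rpow_natCast, ← ENNReal.rpow_mul]
        norm_num

theorem IsOperatorKernel.IsMercer.memLp_kernelIntegral (hM : hK.IsMercer) (f : Lp Y 2 ρX)
    {κ : ℝ} (hκ : ∫⁻ x, ∫⁻ x', ‖K x x'‖ₑ ^ 2 ∂ρX ∂ρX ≤ ENNReal.ofReal (κ ^ 2)) :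
    MemLp (kernelIntegral K ρX f) 2 ρX := by
  let _ : NormedSpace ℝ Y := NormedSpace.restrictScalars ℝ 𝕜 Y
  refine ⟨?_, (hM.eLpNorm_kernelIntegral_le f hκ).trans_lt (by finiteness)⟩
  exact (hM.stronglyMeasurable_comp (Lp.stronglyMeasurable f)).integral_prod_right'
    |>.aestronglyMeasurable

theorem IsOperatorKernel.IsMercer.ae_integrable (hM : hK.IsMercer) {κ : ℝ}
    (hκ : ∫⁻ x, ∫⁻ x', ‖K x x'‖ₑ ^ 2 ∂ρX ∂ρX ≤ ENNReal.ofReal (κ ^ 2)) :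
    ∀ᵐ x ∂ρX, ∀ f : Lp Y 2 ρX, Integrable (fun t => K x t (f t)) ρX := by
  have hfin : ∀ᵐ x ∂ρX, ∫⁻ t, ‖K x t‖ₑ ^ 2 ∂ρX < ∞ :=
    ae_lt_top (hM.measurable_enorm.pow_const 2).lintegral_prod_right'
      (hκ.trans_lt ENNReal.ofReal_lt_top).ne
  filter_upwards [hfin] with x hx f
  refine ⟨((hM.stronglyMeasurable_comp (Lp.stronglyMeasurable f)).comp_measurable
    (measurable_prodMk_left (x := x))).aestronglyMeasurable, ?_⟩
  exact (hM.lintegral_enorm_le f x).trans_lt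
    (ENNReal.mul_lt_top (ENNReal.rpow_lt_top_of_nonneg (by norm_num) hx.ne) (by finiteness))

/-- The integral operator `(L_K f)(x) = ∫ K(x, t) f(t) dρ(t)` on `L²(X, ρ; Y)` of a Mercer kernel
with `∫∫ ‖K(x, x')‖² ≤ κ²`. -/
noncomputable def kernelIntegralOperator (hM : hK.IsMercer) {κ : ℝ}
    (hκ : ∫⁻ x, ∫⁻ x', ‖K x x'‖ₑ ^ 2 ∂ρX ∂ρX ≤ ENNReal.ofReal (κ ^ 2)) :
    Lp Y 2 ρX →L[𝕜] Lp Y 2 ρX :=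
  LinearMap.mkContinuous
    { toFun := fun f => (hM.memLp_kernelIntegral f hκ).toLp _
      map_add' := fun f g => by
        let _ : NormedSpace ℝ Y := NormedSpace.restrictScalars ℝ 𝕜 Y
        rw [← MemLp.toLp_add, MemLp.toLp_eq_toLp_iff]
        filter_upwards [hM.ae_integrable hκ] with x hx
        change ∫ t, K x t ((f + g : Lp Y 2 ρX) t) ∂ρX =
          ∫ t, K x t (f t) ∂ρX + ∫ t, K x t (g t) ∂ρX
        rw [← integral_add (hx f) (hx g)]
        refine integral_congr_ae ?_
        filter_upwards [Lp.coeFn_add f g] with t ht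
        rw [ht, Pi.add_apply, map_add]
      map_smul' := fun c f => by
        let _ : NormedSpace ℝ Y := NormedSpace.restrictScalars ℝ 𝕜 Y
        have : IsScalarTower ℝ 𝕜 Y := IsScalarTower.of_algebraMap_smul fun _ _ => rfl
        rw [RingHom.id_apply, ← MemLp.toLp_const_smul, MemLp.toLp_eq_toLp_iff]
        refine Filter.Eventually.of_forall fun x => ?_
        change ∫ t, K x t ((c • f : Lp Y 2 ρX) t) ∂ρX = c • ∫ t, K x t (f t) ∂ρX
        rw [← integral_smul]
        refine integral_congr_ae ?_
        filter_upwards [Lp.coeFn_smul c f] with t ht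
        rw [ht, Pi.smul_apply, map_smul] }
    |κ| fun f => by
      have h := hM.eLpNorm_kernelIntegral_le f hκ
      rw [LinearMap.coe_mk, AddHom.coe_mk, Lp.norm_toLp]
      refine ENNReal.toReal_le_of_le_ofReal (by positivity) (h.trans_eq ?_)
      rw [ENNReal.ofReal_mul (abs_nonneg _), ofReal_norm]

theorem kernelIntegralOperator_ae_eq (hM : hK.IsMercer) {κ : ℝ}
    (hκ : ∫⁻ x, ∫⁻ x', ‖K x x'‖ₑ ^ 2 ∂ρX ∂ρX ≤ ENNReal.ofReal (κ ^ 2)) (f : Lp Y 2 ρX) :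
    kernelIntegralOperator hM hκ f =ᵐ[ρX] kernelIntegral K ρX f :=
  MemLp.coeFn_toLp (hM.memLp_kernelIntegral f hκ)

end Kernel

/-! ### Interpolation spaces -/

section Interpolation
open MeasureTheory
open scoped ENNReal

section Power
variable {𝕜 H : Type*} [RCLike 𝕜] [NormedAddCommGroup H] [InnerProductSpace 𝕜 H] [CompleteSpace H]

/-- The space `{L ^ (β / 2) f | f ∈ (ker L)ᗮ}`. -/
noncomputable def interpolationSpace (L : H →L[𝕜] H) (β : ℝ) : Submodule 𝕜 H :=
  Submodule.map (operatorPow L (β / 2)).toLinearMap (LinearMap.ker L.toLinearMap)ᗮ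

/-- The norm `‖L ^ (β / 2) f‖ := ‖f‖`, `f ∈ (ker L)ᗮ`, of the space `interpolationSpace L β`,
extended by `∞` outside this space. For a positive operator `L`, `L ^ (β / 2)` is injective on
`(ker L)ᗮ`, so that the infimum runs over at most one `f`. -/
noncomputable def interpolationNorm (L : H →L[𝕜] H) (β : ℝ) (g : H) : ℝ≥0∞ :=
  ⨅ (f : H) (_ : f ∈ (LinearMap.ker L.toLinearMap)ᗮ) (_ : operatorPow L (β / 2) f = g), ‖f‖ₑ

end Power

section Real
variable {G : Type*} [AddCommGroup G]

/-- The `K`-functional `K(f, t, G₁, G₂)` of two normed spaces `G₁, G₂` inside `G`; the arguments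
`N₁, N₂` are their norms, extended by `∞` to the elements of `G` outside `G₁`, respectively `G₂`. -/
noncomputable def kFunctional (N₁ N₂ : G → ℝ≥0∞) (f : G) (t : ℝ) : ℝ≥0∞ :=
  ⨅ (f₁ : G) (f₂ : G) (_ : f = f₁ + f₂), N₁ f₁ + ENNReal.ofReal t * N₂ f₂

/-- The norm `‖f‖_{β,2} = (∫₀^∞ (t ^ (-β) K(f, t, G₁, G₂))² t⁻¹ dt) ^ (1 / 2)`. -/
noncomputable def realInterpolationNorm (N₁ N₂ : G → ℝ≥0∞) (β : ℝ) (f : G) : ℝ≥0∞ :=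
  (∫⁻ t in Set.Ioi (0 : ℝ),
    (ENNReal.ofReal (t ^ (-β)) * kFunctional N₁ N₂ f t) ^ 2 * ENNReal.ofReal t⁻¹) ^ (1 / 2 : ℝ)

/-- The real interpolation space `[G₁, G₂]_{β,2} = {f ∈ G₁ + G₂ | ‖f‖_{β,2} < ∞}`. -/
def realInterpolationSpace (N₁ N₂ : G → ℝ≥0∞) (β : ℝ) : Set G :=
  {f | (∃ f₁ f₂, f = f₁ + f₂ ∧ N₁ f₁ < ∞ ∧ N₂ f₂ < ∞) ∧ realInterpolationNorm N₁ N₂ β f < ∞}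

end Real

end Interpolation

open MeasureTheory
open scoped ENNReal

/-! Write `A = L ^ (1/2)`. On `(ker L)ᗮ` the `K`-functional for `H` and `ran A` minimizes `‖f - A h‖
+ t ‖h‖`. Since `a² + b² ≤ (a + b)² ≤ 2 (a² + b²)` for `a, b ≥ 0`, its square is, up to a factor 2,
the minimum of `‖f - A h‖² + t² ‖h‖²`. That quadratic problem is solved exactly: the minimizer is `A
(t² + L)⁻¹ f` and the minimum is `t² ⟪(t² + L)⁻¹ f, f⟫` (`sq_norm_add_sq_norm_eq`). Hence
`‖f‖_{β,2}²` lies between `Q(f)` and `2 Q(f)`, where `Q(f) = ∫₀^∞ t ^ (1 - 2β) ⟪(t² + L)⁻¹ f, f⟫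
dt`.

By Tonelli, `Q(f)` is the integral of `J(r) = ∫₀^∞ t ^ (1 - 2β) (t² + r)⁻¹ dt` against the spectral
measure of `f`, and `J(r) = r ^ (-β) J(1)` for `r > 0` by scaling. If `f = L ^ (β/2) g` with `g ∈
(ker L)ᗮ`, the powers of `r` cancel and `Q(f) = J(1) ‖g‖²` (`resolventFormIntegral_operatorPow`).
This gives both norm bounds and one inclusion.

Conversely, if `Q(f) < ∞`, the vectors `(L + ε) ^ (-β/2) f` are bounded uniformly in `ε`. Therefore
`|⟪f, x⟫| ≤ C ‖L ^ (β/2) x‖` for all `x`, which forces `f ∈ ran L ^ (β/2)`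
(`mem_range_operatorPow`).

All of this needs only `L ≥ 0`. For the integral operator, positivity follows from that of the
kernel by averaging its quadratic forms over independent samples. -/

/-! ### Spectral measures, and kernels of powers. -/

section FunctionalCalculus
open Polynomial ContinuousLinearMap
open scoped InnerProductSpace

variable {𝕜 H : Type*} [RCLike 𝕜] [NormedAddCommGroup H] [InnerProductSpace 𝕜 H] [CompleteSpace H]

attribute [local instance] operatorRealAlgebra

theorem inner_cfc_left (L : H →L[𝕜] H) (φ : ℝ → ℝ) (x y : H) :
    ⟪cfc φ L x, y⟫_𝕜 = ⟪x, cfc φ L y⟫_𝕜 := by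
  have h : IsSelfAdjoint (cfc φ L) := cfc_predicate φ L
  have := ContinuousLinearMap.adjoint_inner_left (cfc φ L) y x
  rwa [h.adjoint_eq] at this

theorem cfc_cfc_apply (L : H →L[𝕜] H) {φ ψ : ℝ → ℝ} (hφ : ContinuousOn φ (spectrum ℝ L))
    (hψ : ContinuousOn ψ (spectrum ℝ L)) (x : H) :
    cfc φ L (cfc ψ L x) = cfc (fun r => φ r * ψ r) L x := by
  rw [cfc_mul φ ψ L hφ hψ, mul_apply_eq_comp]

theorem re_inner_cfc_nonneg (L : H →L[𝕜] H) {φ : ℝ → ℝ} (h0 : ∀ r ∈ spectrum ℝ L, 0 ≤ φ r)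
    (g : H) : 0 ≤ RCLike.re ⟪cfc φ L g, g⟫_𝕜 := by
  have : 0 ≤ cfc φ L := cfc_nonneg h0
  exact ((nonneg_iff_isPositive _).mp this).re_inner_nonneg_left g

/-- The spectral measure of a self-adjoint operator at a vector. -/
theorem exists_spectralMeasure {L : H →L[𝕜] H} (hL : IsSelfAdjoint L) (g : H) :
    ∃ μ : Measure (spectrum ℝ L), IsFiniteMeasure μ ∧ ∀ φ : ℝ → ℝ,
      ContinuousOn φ (spectrum ℝ L) → (∀ r ∈ spectrum ℝ L, 0 ≤ φ r) →
      ∫⁻ r, ENNReal.ofReal (φ r) ∂μ = ENNReal.ofReal (RCLike.re ⟪cfc φ L g, g⟫_𝕜) := by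
  have : CompactSpace (spectrum ℝ L) := isCompact_iff_compactSpace.mp (spectrum.isCompact L)
  -- Riesz–Markov–Kakutani on the compact spectrum, for the positive functional `φ ↦ re ⟪φ(L) g,
  -- g⟫`.
  let Λ : CompactlySupportedContinuousMap (spectrum ℝ L) ℝ →ₚ[ℝ] ℝ :=
    PositiveLinearMap.mk₀
      { toFun := fun φ => RCLike.re ⟪cfcHom hL (φ : C(spectrum ℝ L, ℝ)) g, g⟫_𝕜
        map_add' := fun φ ψ => by
          have : ((φ + ψ : CompactlySupportedContinuousMap (spectrum ℝ L) ℝ) :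
            C(spectrum ℝ L, ℝ)) = φ + ψ := rfl
          rw [this, map_add, _root_.add_apply, inner_add_left, map_add]
        map_smul' := fun c φ => by
          have : ((c • φ : CompactlySupportedContinuousMap (spectrum ℝ L) ℝ) :
            C(spectrum ℝ L, ℝ)) = c • (φ : C(spectrum ℝ L, ℝ)) := rfl
          rw [this, map_smul, real_smul_operator, _root_.smul_apply, inner_smul_left,
            RCLike.conj_ofReal, RCLike.re_ofReal_mul]
          rfl }
      fun φ hφ => by
        have : 0 ≤ cfcHom hL (φ : C(spectrum ℝ L, ℝ)) := cfcHom_nonneg_iff hL |>.mpr hφ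
        exact ((nonneg_iff_isPositive _).mp this).re_inner_nonneg_left g
  refine ⟨RealRMK.rieszMeasure Λ, inferInstance, fun φ hφ h0 => ?_⟩
  let φ' : C(spectrum ℝ L, ℝ) := ⟨_, hφ.domRestrict⟩
  have h := RealRMK.integral_rieszMeasure Λ (CompactlySupportedContinuousMap.continuousMapEquiv φ')
  have hi : Integrable φ' (RealRMK.rieszMeasure Λ) :=
    φ'.continuous.integrable_of_hasCompactSupport (HasCompactSupport.of_compactSpace _)
  change ∫ x, φ' x ∂_ = RCLike.re ⟪cfcHom hL φ' g, g⟫_𝕜 at h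
  rw [cfc_apply φ L hL hφ, ← h, ofReal_integral_eq_lintegral_ofReal hi]
  · rfl
  · exact Filter.Eventually.of_forall fun x => h0 x x.2

theorem re_inner_cfc_self_cfc (L : H →L[𝕜] H) {φ : ℝ → ℝ} (hφ : ContinuousOn φ (spectrum ℝ L))
    (g : H) : RCLike.re ⟪cfc (fun r => φ r ^ 2) L g, g⟫_𝕜 = ‖cfc φ L g‖ ^ 2 := by
  simp_rw [pow_two (φ _)]
  rw [← cfc_cfc_apply L hφ hφ, inner_cfc_left, inner_self_eq_norm_sq]

/-- The function `c² - φ²` is nonnegative on the spectrum, so its quadratic form `c² ‖g‖² - ‖φ(L)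
g‖²` is nonnegative. -/
theorem norm_cfc_apply_le {L : H →L[𝕜] H} (hL : IsSelfAdjoint L) {φ : ℝ → ℝ}
    (hφ : ContinuousOn φ (spectrum ℝ L)) {c : ℝ} (hc : 0 ≤ c)
    (h : ∀ r ∈ spectrum ℝ L, |φ r| ≤ c) (g : H) : ‖cfc φ L g‖ ≤ c * ‖g‖ := by
  have h1 := re_inner_cfc_nonneg L (φ := fun r => c ^ 2 - φ r ^ 2)
    (fun r hr => sub_nonneg.mpr (sq_le_sq' (abs_le.mp (h r hr)).1 (abs_le.mp (h r hr)).2)) g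
  rw [cfc_sub (fun _ => c ^ 2) (fun r => φ r ^ 2) L continuousOn_const (hφ.pow 2),
    cfc_const (c ^ 2) L hL, algebraMap_operator, _root_.sub_apply, _root_.smul_apply,
    one_apply_eq_self, inner_sub_left, map_sub, inner_smul_left, RCLike.conj_ofReal,
    RCLike.re_ofReal_mul, inner_self_eq_norm_sq, re_inner_cfc_self_cfc L hφ, ← mul_pow] at h1
  exact le_of_sq_le_sq (by linarith) (by positivity)

theorem nonneg_of_mem_spectrum {L : H →L[𝕜] H} (hL : 0 ≤ L) {r : ℝ} (hr : r ∈ spectrum ℝ L) :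
    0 ≤ r := spectrum_nonneg_of_nonneg hL hr

theorem operatorPow_eq_cfc {L : H →L[𝕜] H} (hL : 0 ≤ L) (s : ℝ) :
    operatorPow L s = cfc (fun r : ℝ => r ^ s) L :=
  CFC.rpow_eq_cfc_real hL

omit [CompleteSpace H] in
theorem continuousOn_rpow_spectrum {L : H →L[𝕜] H} {s : ℝ} (hs : 0 ≤ s) :
    ContinuousOn (fun r : ℝ => r ^ s) (spectrum ℝ L) :=
  (Real.continuous_rpow_const hs).continuousOn

theorem continuousOn_inv_add_spectrum {L : H →L[𝕜] H} (hL : 0 ≤ L) {s : ℝ} (hs : 0 < s) :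
    ContinuousOn (fun r : ℝ => (s + r)⁻¹) (spectrum ℝ L) := by
  refine ContinuousOn.inv₀ (by fun_prop) fun r hr => ?_
  have := nonneg_of_mem_spectrum hL hr
  positivity

theorem continuousOn_add_rpow_spectrum {L : H →L[𝕜] H} (hL : 0 ≤ L) {ε : ℝ} (hε : 0 < ε) (s : ℝ) :
    ContinuousOn (fun r : ℝ => (r + ε) ^ s) (spectrum ℝ L) := by
  refine ContinuousOn.rpow_const (by fun_prop) fun r hr => Or.inl ?_
  have := nonneg_of_mem_spectrum hL hr
  positivity

/-- The powers of a positive operator have the kernel of the operator. -/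
theorem ker_operatorPow {L : H →L[𝕜] H} (hL : 0 ≤ L) {s : ℝ} (hs : 0 < s) :
    LinearMap.ker (operatorPow L s).toLinearMap = LinearMap.ker L.toLinearMap := by
  have hsa : IsSelfAdjoint L := IsSelfAdjoint.of_nonneg hL
  ext g
  obtain ⟨μ, -, hμ⟩ := exists_spectralMeasure hsa g
  -- As `‖φ(L) g‖² = ∫ φ² dμ`, a function vanishing exactly at `0` annihilates `g` iff `μ` is
  -- concentrated at `0`. This condition does not involve `φ`, so `r ^ s` and `r` can be compared.
  have key : ∀ φ : ℝ → ℝ, ContinuousOn φ (spectrum ℝ L) → (∀ r, 0 ≤ r → (φ r = 0 ↔ r = 0)) →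
      (cfc φ L g = 0 ↔ ∀ᵐ r : spectrum ℝ L ∂μ, (r : ℝ) = 0) := by
    intro φ hφ h
    have h1 := hμ (fun r => φ r ^ 2) (hφ.pow 2) fun r _ => sq_nonneg _
    rw [re_inner_cfc_self_cfc L hφ] at h1
    have hm : Measurable fun r : spectrum ℝ L => ENNReal.ofReal (φ r ^ 2) :=
      (hφ.domRestrict.pow 2).measurable.ennreal_ofReal
    have h2 : cfc φ L g = 0 ↔ ENNReal.ofReal (‖cfc φ L g‖ ^ 2) = 0 := by
      rw [ENNReal.ofReal_eq_zero, ← norm_eq_zero]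
      exact ⟨fun h => by simp [h], fun h => by nlinarith [norm_nonneg (cfc φ L g)]⟩
    rw [h2, ← h1, lintegral_eq_zero_iff hm]
    refine Filter.eventually_congr (Filter.Eventually.of_forall fun r => ?_)
    simp only [Pi.zero_apply, ENNReal.ofReal_eq_zero]
    rw [← h r (nonneg_of_mem_spectrum hL r.2)]
    exact ⟨fun h => by nlinarith, fun h => by simp [h]⟩
  rw [LinearMap.mem_ker, LinearMap.mem_ker, ContinuousLinearMap.coe_coe,
    ContinuousLinearMap.coe_coe, operatorPow_eq_cfc hL]
  conv_rhs => rw [← cfc_id ℝ L]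
  rw [key _ (continuousOn_rpow_spectrum hs.le), key _ continuousOn_id]
  · simp
  · intro r hr
    rw [Real.rpow_eq_zero hr hs.ne']

theorem range_operatorPow_eq_interpolationSpace {L : H →L[𝕜] H} (hL : 0 ≤ L) {β : ℝ} (hβ : 0 < β) :
    LinearMap.range (operatorPow L (β / 2)).toLinearMap = interpolationSpace L β := by
  refine le_antisymm ?_ LinearMap.map_le_range
  rintro _ ⟨f, rfl⟩
  have : IsClosed (LinearMap.ker L.toLinearMap : Set H) := L.isClosed_ker
  have : CompleteSpace (LinearMap.ker L.toLinearMap) := this.completeSpace_coe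
  obtain ⟨y, hy, z, hz, rfl⟩ := (LinearMap.ker L.toLinearMap).exists_add_mem_mem_orthogonal f
  refine ⟨z, hz, ?_⟩
  rw [← ker_operatorPow hL (half_pos hβ)] at hy
  rw [map_add, LinearMap.mem_ker.mp hy, zero_add]

/-- Two preimages in `(ker L)ᗮ` differ by an element of `ker L ∩ (ker L)ᗮ = 0`, so the infimum has
one term. -/
theorem interpolationNorm_operatorPow {L : H →L[𝕜] H} (hL : 0 ≤ L) {β : ℝ} (hβ : 0 < β) {f : H}
    (hf : f ∈ (LinearMap.ker L.toLinearMap)ᗮ) :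
    interpolationNorm L β (operatorPow L (β / 2) f) = ‖f‖ₑ := by
  refine le_antisymm (iInf_le_of_le f (iInf_le_of_le hf (iInf_le _ rfl))) ?_
  refine le_iInf fun h => le_iInf fun hh => le_iInf fun he => ?_
  have h1 : h - f ∈ LinearMap.ker L.toLinearMap := by
    rw [← ker_operatorPow hL (half_pos hβ), LinearMap.mem_ker, ContinuousLinearMap.coe_coe,
      map_sub, he, sub_self]
  have h2 := Submodule.inner_right_of_mem_orthogonal h1 (Submodule.sub_mem _ hh hf)
  rw [inner_self_eq_zero, sub_eq_zero] at h2
  rw [h2]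

/-- The spectral measure at a vector orthogonal to the kernel has no mass at `0`. -/
theorem spectralMeasure_zero {L : H →L[𝕜] H} (hL : 0 ≤ L) {g : H}
    (hg : g ∈ (LinearMap.ker L.toLinearMap)ᗮ) {μ : Measure (spectrum ℝ L)}
    (hμ : ∀ φ : ℝ → ℝ, ContinuousOn φ (spectrum ℝ L) → (∀ r ∈ spectrum ℝ L, 0 ≤ φ r) →
      ∫⁻ r, ENNReal.ofReal (φ r) ∂μ = ENNReal.ofReal (RCLike.re ⟪cfc φ L g, g⟫_𝕜)) :
    μ {r | (r : ℝ) = 0} = 0 := by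
  have hsa : IsSelfAdjoint L := IsSelfAdjoint.of_nonneg hL
  -- The function `ε / (ε + r)` is `1` at `r = 0`, so `μ {0} ≤ ⟪V g, g⟫` with `V = ε (ε + L)⁻¹`.
  -- Split `g = L u + (g - L u)` and use `‖V‖ ≤ 1` and `‖V L‖ ≤ ε`.
  have hbound : ∀ ε : ℝ, 0 < ε → ∀ u : H,
      μ {r | (r : ℝ) = 0} ≤ ENNReal.ofReal ((ε * ‖u‖ + ‖g - L u‖) * ‖g‖) := by
    intro ε hε u
    have hc : ContinuousOn (fun r : ℝ => ε * (ε + r)⁻¹) (spectrum ℝ L) :=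
      (continuousOn_inv_add_spectrum hL hε).const_mul ε |>.congr fun _ _ => rfl
    have h0 : ∀ r ∈ spectrum ℝ L, 0 ≤ ε * (ε + r)⁻¹ := fun r hr => by
      have := nonneg_of_mem_spectrum hL hr; positivity
    have hle : ∀ r ∈ spectrum ℝ L, ε * (ε + r)⁻¹ ≤ 1 := fun r hr => by
      have := nonneg_of_mem_spectrum hL hr
      rw [mul_inv_le_iff₀ (by positivity)]; linarith
    calc μ {r | (r : ℝ) = 0}
        = ∫⁻ r in {r : spectrum ℝ L | (r : ℝ) = 0}, 1 ∂μ := by simp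
      _ = ∫⁻ r in {r : spectrum ℝ L | (r : ℝ) = 0}, ENNReal.ofReal (ε * (ε + r)⁻¹) ∂μ := by
          refine setLIntegral_congr_fun (measurableSet_eq_fun (by fun_prop) (by fun_prop)) ?_
          intro r hr
          simp only [Set.mem_ofPred_eq] at hr
          simp [hr, hε.ne']
      _ ≤ ∫⁻ r, ENNReal.ofReal (ε * (ε + r)⁻¹) ∂μ := setLIntegral_le_lintegral _ _
      _ = ENNReal.ofReal (RCLike.re ⟪cfc (fun r : ℝ => ε * (ε + r)⁻¹) L g, g⟫_𝕜) := hμ _ hc h0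
      _ ≤ _ := by
          refine ENNReal.ofReal_le_ofReal ((RCLike.re_le_norm _).trans
            ((norm_inner_le_norm _ _).trans ?_))
          gcongr
          set V := cfc (fun r : ℝ => ε * (ε + r)⁻¹) L with hV
          have hVn : ∀ x, ‖V x‖ ≤ 1 * ‖x‖ := fun x => by
            refine norm_cfc_apply_le hsa hc zero_le_one (fun r hr => ?_) x
            rw [abs_of_nonneg (h0 r hr)]; exact hle r hr
          have hVL : ‖V (L u)‖ ≤ ε * ‖u‖ := by
            have h1 : V (L u) = cfc (fun r : ℝ => ε * (ε + r)⁻¹ * r) L u := by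
              have := cfc_cfc_apply L hc continuousOn_id u
              rwa [cfc_id ℝ L] at this
            rw [h1]
            refine norm_cfc_apply_le hsa (hc.mul continuousOn_id) hε.le (fun r hr => ?_) u
            have := nonneg_of_mem_spectrum hL hr
            change |ε * (ε + r)⁻¹ * r| ≤ ε
            rw [abs_of_nonneg (by positivity), mul_assoc]
            refine mul_le_of_le_one_right hε.le ?_
            rw [inv_mul_le_iff₀ (by positivity)]; linarith
          calc ‖V g‖ = ‖V (L u) + V (g - L u)‖ := by rw [← map_add]; simp
            _ ≤ ‖V (L u)‖ + ‖V (g - L u)‖ := norm_add_le _ _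
            _ ≤ _ := by
              gcongr
              simpa using hVn (g - L u)
  have hcl : g ∈ closure (Set.range L) := by
    have h1 : g ∈ L.rangeᗮᗮ := by
      rw [ContinuousLinearMap.orthogonal_range, hsa.adjoint_eq]; exact hg
    rw [Submodule.orthogonal_orthogonal_eq_closure] at h1
    rw [← SetLike.mem_coe, Submodule.topologicalClosure_coe] at h1
    exact h1
  refine le_antisymm (ENNReal.le_of_forall_pos_le_add fun δ hδ _ => ?_) (zero_le)
  rw [zero_add]
  -- First `u` makes `‖g - L u‖` small, then `ε` is chosen depending on `u`. The summands `+ 1` only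
  -- keep the denominators positive.
  obtain ⟨_, ⟨u, rfl⟩, hu⟩ := Metric.mem_closure_iff.mp hcl (δ / (2 * (‖g‖ + 1)))
    (by positivity)
  refine (hbound (δ / (2 * (‖u‖ + 1) * (‖g‖ + 1))) (by positivity) u).trans ?_
  rw [← ENNReal.ofReal_coe_nnreal]
  refine ENNReal.ofReal_le_ofReal ?_
  rw [dist_eq_norm] at hu
  have h1 : (δ : ℝ) / (2 * (‖u‖ + 1) * (‖g‖ + 1)) * ‖u‖ ≤ δ / (2 * (‖g‖ + 1)) := by
    rw [div_mul_eq_mul_div, div_le_div_iff₀ (by positivity) (by positivity)]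
    have : 0 ≤ (δ : ℝ) * (2 * (‖g‖ + 1)) := by positivity
    nlinarith
  calc _ ≤ (δ / (2 * (‖g‖ + 1)) + δ / (2 * (‖g‖ + 1))) * (‖g‖ + 1) := by
        gcongr
        linarith
    _ = δ := by field_simp; ring

end FunctionalCalculus

/-! ### The `K`-functional as a quadratic minimization. -/

section KFunctional
open ContinuousLinearMap
open scoped InnerProductSpace

variable {𝕜 H : Type*} [RCLike 𝕜] [NormedAddCommGroup H] [InnerProductSpace 𝕜 H] [CompleteSpace H]

attribute [local instance] operatorRealAlgebra

theorem operatorPow_half_half {L : H →L[𝕜] H} (hL : 0 ≤ L) (x : H) :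
    operatorPow L (1 / 2) (operatorPow L (1 / 2) x) = L x := by
  have hc : ContinuousOn (fun r : ℝ => r ^ (1 / 2 : ℝ)) (spectrum ℝ L) :=
    continuousOn_rpow_spectrum (by norm_num)
  rw [operatorPow_eq_cfc hL, cfc_cfc_apply L hc hc]
  conv_rhs => rw [← cfc_id ℝ L (IsSelfAdjoint.of_nonneg hL)]
  rw [cfc_congr (g := id)]
  intro r hr
  have := nonneg_of_mem_spectrum hL hr
  simp only [id]
  rw [← Real.sqrt_eq_rpow, Real.mul_self_sqrt this]

theorem inner_operatorPow_left {L : H →L[𝕜] H} (hL : 0 ≤ L) (s : ℝ) (x y : H) :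
    ⟪operatorPow L s x, y⟫_𝕜 = ⟪x, operatorPow L s y⟫_𝕜 := by
  rw [operatorPow_eq_cfc hL, inner_cfc_left]

theorem operatorPow_mem_orthogonal_ker {L : H →L[𝕜] H} (hL : 0 ≤ L) {s : ℝ} (hs : 0 < s) (x : H) :
    operatorPow L s x ∈ (LinearMap.ker L.toLinearMap)ᗮ := by
  intro v hv
  rw [← ker_operatorPow hL hs] at hv
  rw [← inner_operatorPow_left hL, show operatorPow L s v = 0 from hv, inner_zero_left]

theorem smul_add_apply_resolvent {L : H →L[𝕜] H} (hL : 0 ≤ L) {s : ℝ} (hs : 0 < s) (f : H) :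
    (s : 𝕜) • cfc (fun r : ℝ => (s + r)⁻¹) L f + L (cfc (fun r : ℝ => (s + r)⁻¹) L f) = f := by
  have hsa : IsSelfAdjoint L := IsSelfAdjoint.of_nonneg hL
  have hc := continuousOn_inv_add_spectrum hL hs
  have h1 : cfc (fun r : ℝ => s + r) L = (s : 𝕜) • (1 : H →L[𝕜] H) + L := by
    rw [cfc_const_add s (fun r => r) L continuousOn_id, algebraMap_operator, cfc_id' ℝ L]
  have h2 := cfc_cfc_apply L (φ := fun r : ℝ => s + r) (by fun_prop) hc f
  rw [h1] at h2
  rw [_root_.add_apply, _root_.smul_apply, one_apply_eq_self] at h2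
  rw [h2, cfc_congr (g := fun _ => 1), cfc_const_one ℝ L, one_apply_eq_self]
  intro r hr
  have := nonneg_of_mem_spectrum hL hr
  exact mul_inv_cancel₀ (by positivity)

/-- The value of `‖f - L ^ (1 / 2) h‖ ^ 2 + s * ‖h‖ ^ 2`, `k` being the difference of `h` and the
minimizer. -/
theorem sq_norm_add_sq_norm_eq {L : H →L[𝕜] H} (hL : 0 ≤ L) {s : ℝ} (hs : 0 < s) (f k : H) :
    let A := operatorPow L (1 / 2)
    let u := cfc (fun r : ℝ => (s + r)⁻¹) L f
    ‖f - A (A u + k)‖ ^ 2 + s * ‖A u + k‖ ^ 2 =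
      s * RCLike.re ⟪u, f⟫_𝕜 + ‖A k‖ ^ 2 + s * ‖k‖ ^ 2 := by
  intro A u
  have hf : (s : 𝕜) • u + A (A u) = f := by
    rw [operatorPow_half_half hL]; exact smul_add_apply_resolvent hL hs f
  have h1 : f - A (A u + k) = (s : 𝕜) • u - A k := by
    conv_lhs => rw [← hf, map_add]
    abel
  have h2 : RCLike.re ⟪u, f⟫_𝕜 = s * ‖u‖ ^ 2 + ‖A u‖ ^ 2 := by
    conv_lhs => rw [← hf]
    rw [inner_add_right, map_add, inner_smul_right, RCLike.re_ofReal_mul, inner_self_eq_norm_sq,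
      ← inner_operatorPow_left hL, inner_self_eq_norm_sq]
  -- With `f = s u + A² u`, the cross terms `-2 s re ⟪u, A k⟫` and `2 s re ⟪A u, k⟫` cancel: `A u`
  -- solves the normal equation.
  rw [h1, h2, @norm_sub_sq 𝕜, @norm_add_sq 𝕜, inner_smul_left, RCLike.conj_ofReal,
    RCLike.re_ofReal_mul, inner_operatorPow_left hL, norm_smul, RCLike.norm_ofReal, mul_pow, sq_abs]
  ring

theorem interpolationNorm_eq_top {L : H →L[𝕜] H} {β : ℝ} {g : H} (hg : g ∉ interpolationSpace L β) :
    interpolationNorm L β g = ∞ := by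
  rw [interpolationNorm, iInf_eq_top]
  refine fun f => iInf_eq_top.mpr fun hf => iInf_eq_top.mpr fun he => ?_
  exact absurd ⟨f, hf, he⟩ hg

/-- For `f = f₁ + A h` the quadratic minimum is at most `‖f₁‖² + t² ‖h‖² ≤ (‖f₁‖ + t ‖h‖)²`.
Decompositions with `f₂` outside the space cost `∞`. -/
theorem le_kFunctional_sq {L : H →L[𝕜] H} (hL : 0 ≤ L) (f : H) {t : ℝ} (ht : 0 < t) :
    ENNReal.ofReal (t ^ 2 * RCLike.re ⟪cfc (fun r : ℝ => (t ^ 2 + r)⁻¹) L f, f⟫_𝕜) ≤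
      kFunctional (fun f : H => ‖f‖ₑ) (interpolationNorm L 1) f t ^ 2 := by
  set q := t ^ 2 * RCLike.re ⟪cfc (fun r : ℝ => (t ^ 2 + r)⁻¹) L f, f⟫_𝕜 with hq
  have hq0 : 0 ≤ q := by
    refine mul_nonneg (sq_nonneg _) (re_inner_cfc_nonneg L (fun r hr => ?_) f)
    have := nonneg_of_mem_spectrum hL hr
    positivity
  have key : ENNReal.ofReal √q ≤ kFunctional (fun f : H => ‖f‖ₑ) (interpolationNorm L 1) f t := by
    refine le_iInf fun f₁ => le_iInf fun f₂ => le_iInf fun he => ?_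
    by_cases hf₂ : f₂ ∈ interpolationSpace L 1
    · obtain ⟨h, hh, rfl⟩ := hf₂
      change _ ≤ ‖f₁‖ₑ + ENNReal.ofReal t * interpolationNorm L 1 (operatorPow L (1 / 2) h)
      rw [interpolationNorm_operatorPow hL one_pos hh, ← ofReal_norm, ← ofReal_norm,
        ← ENNReal.ofReal_mul ht.le, ← ENNReal.ofReal_add (by positivity) (by positivity)]
      refine ENNReal.ofReal_le_ofReal (Real.sqrt_le_iff.mpr ⟨by positivity, ?_⟩)
      have h1 := sq_norm_add_sq_norm_eq hL (pow_pos ht 2) f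
        (h - operatorPow L (1 / 2) (cfc (fun r : ℝ => (t ^ 2 + r)⁻¹) L f))
      simp only [add_sub_cancel] at h1
      rw [he, show f₁ + (operatorPow L (1 / 2)).toLinearMap h - operatorPow L (1 / 2) h = f₁ from
        add_sub_cancel_right _ _, ← he, ← hq] at h1
      have h2 : 0 ≤ t * ‖f₁‖ * ‖h‖ := by positivity
      nlinarith [sq_nonneg ‖operatorPow L (1 / 2)
        (h - operatorPow L (1 / 2) (cfc (fun r : ℝ => (t ^ 2 + r)⁻¹) L f))‖,
        sq_nonneg (t * ‖h - operatorPow L (1 / 2) (cfc (fun r : ℝ => (t ^ 2 + r)⁻¹) L f)‖)]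
    · rw [interpolationNorm_eq_top hf₂, ENNReal.mul_top (by simpa using ht), add_top]
      exact le_top
  calc ENNReal.ofReal q = ENNReal.ofReal √q ^ 2 := by
        rw [← ENNReal.ofReal_pow (Real.sqrt_nonneg _), Real.sq_sqrt hq0]
    _ ≤ _ := by gcongr

/-- The decomposition given by the quadratic minimizer is tested, and `(a + b)² ≤ 2 (a² + b²)`. The
minimizer lies in `ran A ⊆ (ker L)ᗮ`, so its norm is the interpolation norm of its image under `A`.
-/
theorem kFunctional_sq_le {L : H →L[𝕜] H} (hL : 0 ≤ L) (f : H) {t : ℝ} (ht : 0 < t) :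
    kFunctional (fun f : H => ‖f‖ₑ) (interpolationNorm L 1) f t ^ 2 ≤
      2 * ENNReal.ofReal (t ^ 2 * RCLike.re ⟪cfc (fun r : ℝ => (t ^ 2 + r)⁻¹) L f, f⟫_𝕜) := by
  have h1 := sq_norm_add_sq_norm_eq hL (pow_pos ht 2) f 0
  simp only [add_zero, map_zero, norm_zero] at h1
  set q := t ^ 2 * RCLike.re ⟪cfc (fun r : ℝ => (t ^ 2 + r)⁻¹) L f, f⟫_𝕜 with hq
  set h := operatorPow L (1 / 2) (cfc (fun r : ℝ => (t ^ 2 + r)⁻¹) L f) with hh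
  have key : kFunctional (fun f : H => ‖f‖ₑ) (interpolationNorm L 1) f t ≤
      ENNReal.ofReal (‖f - operatorPow L (1 / 2) h‖ + t * ‖h‖) := by
    refine iInf_le_of_le (f - operatorPow L (1 / 2) h) (iInf_le_of_le (operatorPow L (1 / 2) h)
      (iInf_le_of_le (by abel) ?_))
    change ‖f - operatorPow L (1 / 2) h‖ₑ + _ ≤ _
    rw [interpolationNorm_operatorPow hL one_pos
      (operatorPow_mem_orthogonal_ker hL (by norm_num) _), ← ofReal_norm, ← ofReal_norm,
        ← ENNReal.ofReal_mul ht.le, ← ENNReal.ofReal_add (by positivity) (by positivity)]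
  calc _ ≤ ENNReal.ofReal (‖f - operatorPow L (1 / 2) h‖ + t * ‖h‖) ^ 2 := by gcongr
    _ ≤ ENNReal.ofReal (2 * q) := by
      rw [← ENNReal.ofReal_pow (by positivity)]
      refine ENNReal.ofReal_le_ofReal ?_
      nlinarith [sq_nonneg (‖f - operatorPow L (1 / 2) h‖ - t * ‖h‖)]
    _ = _ := by rw [ENNReal.ofReal_mul zero_le_two, ENNReal.ofReal_ofNat]

end KFunctional

/-! ### The scalar integral `J(r)`. -/

section ScalarIntegral

/-- The integral `∫₀^∞ t ^ (1 - 2 * β) / (t ^ 2 + r) dt`. -/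
noncomputable def resolventIntegral (β r : ℝ) : ℝ≥0∞ :=
  ∫⁻ t in Set.Ioi (0 : ℝ), ENNReal.ofReal (t ^ (1 - 2 * β) * (t ^ 2 + r)⁻¹)

/-- Substitute `√r * t` for `t`. -/
theorem resolventIntegral_eq (β : ℝ) {r : ℝ} (hr : 0 < r) :
    resolventIntegral β r = ENNReal.ofReal (r ^ (-β)) * resolventIntegral β 1 := by
  have ha : 0 < √r := Real.sqrt_pos.mpr hr
  have him : (fun t => √r * t) '' Set.Ioi (0 : ℝ) = Set.Ioi 0 := by
    rw [Set.image_mul_left_Ioi ha, mul_zero]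
  have hcv := lintegral_image_eq_lintegral_abs_deriv_mul (s := Set.Ioi 0) (f := fun t => √r * t) (f' := fun _ => √r)
    measurableSet_Ioi (fun x _ => by simpa using! ((hasDerivAt_id x).const_mul √r).hasDerivWithinAt)
    (mul_right_injective₀ ha.ne').injOn
    fun t => ENNReal.ofReal (t ^ (1 - 2 * β) * (t ^ 2 + r)⁻¹)
  rw [him] at hcv
  rw [resolventIntegral, resolventIntegral, hcv, ← lintegral_const_mul' _ _ (by finiteness)]
  refine setLIntegral_congr_fun measurableSet_Ioi fun t ht => ?_
  have ht' : 0 < t := ht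
  rw [← ENNReal.ofReal_mul (by positivity), ← ENNReal.ofReal_mul (by positivity)]
  congr 1
  have h1 : √r ^ (1 - 2 * β) = √r * r ^ (-β) := by
    rw [sub_eq_add_neg, Real.rpow_add ha, Real.rpow_one, Real.sqrt_eq_rpow, ← Real.rpow_mul hr.le]
    congr 2; ring
  rw [abs_of_pos ha, Real.mul_rpow ha.le ht'.le, h1, mul_pow, Real.sq_sqrt hr.le]
  have h2 : √r * √r = r := Real.mul_self_sqrt hr.le
  have h3 : (r * t ^ 2 + r)⁻¹ = r⁻¹ * (t ^ 2 + 1)⁻¹ := by rw [← mul_inv]; ring_nf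
  rw [h3]
  calc _ = (√r * √r) * r⁻¹ * (r ^ (-β) * (t ^ (1 - 2 * β) * (t ^ 2 + 1)⁻¹)) := by ring
    _ = _ := by rw [h2, mul_inv_cancel₀ hr.ne', one_mul]

/-- The integrand is at most `t ^ (1 - 2β)` near `0`, integrable because `β < 1`, and at most `t ^
(-1 - 2β)` near `∞`, integrable because `β > 0`. -/
theorem resolventIntegral_lt_top {β : ℝ} (hβ₀ : 0 < β) (hβ₁ : β < 1) :
    resolventIntegral β 1 < ∞ := by
  rw [resolventIntegral, ← Set.Ioc_union_Ioi_eq_Ioi zero_le_one]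
  refine (lintegral_union_le _ _ _).trans_lt (ENNReal.add_lt_top.mpr ⟨?_, ?_⟩)
  · have h : IntegrableOn (fun t : ℝ => t ^ (1 - 2 * β)) (Set.Ioc 0 1) :=
      (intervalIntegrable_iff_integrableOn_Ioc_of_le zero_le_one).mp
        (intervalIntegral.intervalIntegrable_rpow' (by linarith))
    refine lt_of_le_of_lt (setLIntegral_mono' measurableSet_Ioc fun t ht => ?_) h.lintegral_lt_top
    have : 0 < t := ht.1
    refine ENNReal.ofReal_le_ofReal (mul_le_of_le_one_right (by positivity) ?_)
    exact inv_le_one_of_one_le₀ (by nlinarith)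
  · have h : IntegrableOn (fun t : ℝ => t ^ (-1 - 2 * β)) (Set.Ioi 1) :=
      integrableOn_Ioi_rpow_of_lt (by linarith) one_pos
    refine lt_of_le_of_lt (setLIntegral_mono' measurableSet_Ioi fun t ht => ?_) h.lintegral_lt_top
    have ht : 1 < t := ht
    have ht0 : 0 < t := by linarith
    refine ENNReal.ofReal_le_ofReal ?_
    have : t ^ (-1 - 2 * β) = t ^ (1 - 2 * β) * (t ^ 2)⁻¹ := by
      rw [← Real.rpow_natCast, ← Real.rpow_neg ht0.le, ← Real.rpow_add ht0]
      congr 1; push_cast; ring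
    rw [this]
    gcongr
    linarith

theorem resolventIntegral_pos (β : ℝ) : 0 < resolventIntegral β 1 := by
  rw [resolventIntegral, setLIntegral_pos_iff (by fun_prop)]
  refine lt_of_lt_of_le (b := volume (Set.Ioi (0 : ℝ))) (by simp) (measure_mono fun t ht => ⟨?_, ht⟩)
  have ht : 0 < t := ht
  rw [Function.mem_support, ne_eq, ENNReal.ofReal_eq_zero, not_le]
  positivity

end ScalarIntegral

/-! ### The interpolation norm through the spectral measure, and the range criterion. -/

section RealInterpolation
open ContinuousLinearMap
open scoped InnerProductSpace

variable {𝕜 H : Type*} [RCLike 𝕜] [NormedAddCommGroup H] [InnerProductSpace 𝕜 H] [CompleteSpace H]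

attribute [local instance] operatorRealAlgebra

/-- The integral `∫₀^∞ t ^ (1 - 2 * β) ⟪(t ^ 2 + L)⁻¹ f, f⟫ dt`. -/
noncomputable def resolventFormIntegral (L : H →L[𝕜] H) (β : ℝ) (f : H) : ℝ≥0∞ :=
  ∫⁻ t in Set.Ioi (0 : ℝ), ENNReal.ofReal (t ^ (1 - 2 * β)) *
    ENNReal.ofReal (RCLike.re ⟪cfc (fun r : ℝ => (t ^ 2 + r)⁻¹) L f, f⟫_𝕜)

theorem weight_identity (β : ℝ) {t : ℝ} (ht : 0 < t) (q : ℝ) :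
    ENNReal.ofReal (t ^ (1 - 2 * β)) * ENNReal.ofReal q =
      ENNReal.ofReal (t ^ (-β)) ^ 2 * ENNReal.ofReal (t ^ 2 * q) * ENNReal.ofReal t⁻¹ := by
  have h : t ^ (1 - 2 * β) = (t ^ (-β)) ^ 2 * t ^ 2 * t⁻¹ := by
    rw [← Real.rpow_natCast (t ^ (-β)), ← Real.rpow_mul ht.le, ← Real.rpow_natCast t,
      ← Real.rpow_neg_one, ← Real.rpow_add ht, ← Real.rpow_add ht]
    congr 1; push_cast; ring
  rw [h, ENNReal.ofReal_mul (by positivity), ENNReal.ofReal_mul (by positivity),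
    ENNReal.ofReal_mul (p := t ^ 2) (by positivity), ENNReal.ofReal_pow (by positivity)]
  ring

omit [CompleteSpace H] in
theorem sq_realInterpolationNorm (N₁ N₂ : H → ℝ≥0∞) (β : ℝ) (f : H) :
    realInterpolationNorm N₁ N₂ β f ^ 2 = ∫⁻ t in Set.Ioi (0 : ℝ),
      (ENNReal.ofReal (t ^ (-β)) * kFunctional N₁ N₂ f t) ^ 2 * ENNReal.ofReal t⁻¹ := by
  rw [realInterpolationNorm, ← ENNReal.rpow_natCast, ← ENNReal.rpow_mul]
  norm_num

theorem resolventFormIntegral_le {L : H →L[𝕜] H} (hL : 0 ≤ L) (β : ℝ) (f : H) :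
    resolventFormIntegral L β f ≤
      realInterpolationNorm (fun f : H => ‖f‖ₑ) (interpolationNorm L 1) β f ^ 2 := by
  rw [sq_realInterpolationNorm]
  refine setLIntegral_mono' measurableSet_Ioi fun t ht => ?_
  rw [weight_identity β ht, mul_pow]
  gcongr
  exact le_kFunctional_sq hL f ht

theorem sq_realInterpolationNorm_le {L : H →L[𝕜] H} (hL : 0 ≤ L) (β : ℝ) (f : H) :
    realInterpolationNorm (fun f : H => ‖f‖ₑ) (interpolationNorm L 1) β f ^ 2 ≤
      2 * resolventFormIntegral L β f := by
  rw [sq_realInterpolationNorm, resolventFormIntegral, ← lintegral_const_mul' _ _ (by finiteness)]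
  refine setLIntegral_mono' measurableSet_Ioi fun t ht => ?_
  rw [weight_identity β ht, mul_pow, ← mul_assoc, mul_left_comm]
  gcongr
  exact kFunctional_sq_le hL f ht

/-- Moving `φ(L)` across the inner product turns the form at `φ(L) g` into one at `g` with the extra
factor `φ²`; Tonelli then isolates `J(r)`. -/
theorem resolventFormIntegral_cfc {L : H →L[𝕜] H} (hL : 0 ≤ L) (β : ℝ) {φ : ℝ → ℝ}
    (hφ : ContinuousOn φ (spectrum ℝ L)) {g : H} {μ : Measure (spectrum ℝ L)} [IsFiniteMeasure μ]
    (hμ : ∀ φ : ℝ → ℝ, ContinuousOn φ (spectrum ℝ L) → (∀ r ∈ spectrum ℝ L, 0 ≤ φ r) →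
      ∫⁻ r, ENNReal.ofReal (φ r) ∂μ = ENNReal.ofReal (RCLike.re ⟪cfc φ L g, g⟫_𝕜)) :
    resolventFormIntegral L β (cfc φ L g) =
      ∫⁻ r, ENNReal.ofReal (φ r ^ 2) * resolventIntegral β r ∂μ := by
  have h1 : ∀ t ∈ Set.Ioi (0 : ℝ), ENNReal.ofReal (t ^ (1 - 2 * β)) * ENNReal.ofReal
      (RCLike.re ⟪cfc (fun r : ℝ => (t ^ 2 + r)⁻¹) L (cfc φ L g), cfc φ L g⟫_𝕜) =
      ∫⁻ r, ENNReal.ofReal (φ r ^ 2) * ENNReal.ofReal (t ^ (1 - 2 * β) * (t ^ 2 + r)⁻¹) ∂μ := by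
    intro t ht
    have ht : 0 < t := ht
    have hc := continuousOn_inv_add_spectrum hL (pow_pos ht 2)
    have hm : ContinuousOn (fun r => (t ^ 2 + r)⁻¹ * φ r) (spectrum ℝ L) := hc.mul hφ
    rw [← inner_cfc_left, cfc_cfc_apply L hc hφ, cfc_cfc_apply L hφ hm, ← hμ (fun r => φ r * ((t ^ 2 + r)⁻¹ * φ r)) (hφ.mul hm),
      ← lintegral_const_mul' _ _ (by finiteness)]
    · refine lintegral_congr fun r => ?_
      rw [← ENNReal.ofReal_mul (by positivity), ← ENNReal.ofReal_mul (by positivity)]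
      congr 1; ring
    · intro r hr
      have := nonneg_of_mem_spectrum hL hr
      have h2 : φ r * ((t ^ 2 + r)⁻¹ * φ r) = φ r ^ 2 * (t ^ 2 + r)⁻¹ := by ring
      rw [h2]; positivity
  rw [resolventFormIntegral, setLIntegral_congr_fun measurableSet_Ioi h1, lintegral_lintegral_swap]
  · refine lintegral_congr fun r => ?_
    rw [lintegral_const_mul' _ _ (by finiteness)]
    rfl
  · refine Measurable.aemeasurable ?_
    have hm : Measurable fun p : ℝ × spectrum ℝ L => φ p.2 :=
      hφ.domRestrict.measurable.comp measurable_snd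
    have : Measurable fun p : ℝ × spectrum ℝ L => (p.2 : ℝ) := 
      measurable_subtype_coe.comp measurable_snd
    exact (hm.pow_const 2).ennreal_ofReal.mul (by fun_prop : Measurable fun p : ℝ × spectrum ℝ L =>
      ENNReal.ofReal (p.1 ^ (1 - 2 * β) * (p.1 ^ 2 + p.2)⁻¹))

theorem resolventFormIntegral_operatorPow {L : H →L[𝕜] H} (hL : 0 ≤ L) {β : ℝ} (hβ : 0 < β) {g : H}
    (hg : g ∈ (LinearMap.ker L.toLinearMap)ᗮ) :
    resolventFormIntegral L β (operatorPow L (β / 2) g) = resolventIntegral β 1 * ‖g‖ₑ ^ 2 := by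
  have hsa : IsSelfAdjoint L := IsSelfAdjoint.of_nonneg hL
  obtain ⟨μ, _, hμ⟩ := exists_spectralMeasure hsa g
  rw [operatorPow_eq_cfc hL, resolventFormIntegral_cfc hL β
    (continuousOn_rpow_spectrum (half_pos hβ).le) hμ]
  -- Off `r = 0` the integrand is `r ^ β * (r ^ (-β) J(1)) = J(1)`. At `r = 0` it would be `0`, so
  -- the point must be null; this is where `g ∈ (ker L)ᗮ` enters.
  have h0 : ∀ᵐ r : spectrum ℝ L ∂μ, (r : ℝ) ≠ 0 := by
    rw [ae_iff]
    simpa using spectralMeasure_zero hL hg hμ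
  have h1 := hμ (fun _ => 1) continuousOn_const fun _ _ => zero_le_one
  rw [cfc_const_one ℝ L, one_apply_eq_self, inner_self_eq_norm_sq,
    ENNReal.ofReal_pow (norm_nonneg _), ofReal_norm] at h1
  rw [← h1, ← lintegral_const_mul _ (by fun_prop)]
  refine lintegral_congr_ae ?_
  filter_upwards [h0] with r hr
  have hr : 0 < (r : ℝ) := lt_of_le_of_ne (nonneg_of_mem_spectrum hL r.2) hr.symm
  rw [resolventIntegral_eq β hr, ← mul_assoc, ← ENNReal.ofReal_mul (by positivity), mul_comm]
  congr 2
  rw [← Real.rpow_natCast, ← Real.rpow_mul hr.le, ← Real.rpow_add hr, ← Real.rpow_zero (r : ℝ)]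
  congr 1; push_cast; ring

theorem resolventIntegral_anti (β : ℝ) {r s : ℝ} (hr : 0 ≤ r) (hrs : r ≤ s) :
    resolventIntegral β s ≤ resolventIntegral β r := by
  refine setLIntegral_mono' measurableSet_Ioi fun t ht => ENNReal.ofReal_le_ofReal ?_
  have ht : 0 < t := ht
  gcongr

/-- Since `J` is decreasing, `(r + ε) ^ (-β) J(1) = J(r + ε) ≤ J(r)`. The shift by `ε` keeps the
negative power continuous on a spectrum that may contain `0`. -/
theorem norm_regularized_le {L : H →L[𝕜] H} (hL : 0 ≤ L) (β : ℝ) (f : H) {ε : ℝ} (hε : 0 < ε) :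
    resolventIntegral β 1 * ‖cfc (fun r : ℝ => (r + ε) ^ (-(β / 2))) L f‖ₑ ^ 2 ≤
      resolventFormIntegral L β f := by
  have hsa : IsSelfAdjoint L := IsSelfAdjoint.of_nonneg hL
  obtain ⟨μ, _, hμ⟩ := exists_spectralMeasure hsa f
  have h1 := resolventFormIntegral_cfc hL β (φ := fun _ => 1) continuousOn_const hμ
  rw [cfc_const_one ℝ L, one_apply_eq_self] at h1
  have hc := continuousOn_add_rpow_spectrum hL hε (-(β / 2))
  have h2 := hμ (fun r => ((r + ε) ^ (-(β / 2))) ^ 2) (hc.pow 2) fun _ _ => sq_nonneg _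
  rw [re_inner_cfc_self_cfc L hc, ENNReal.ofReal_pow (norm_nonneg _), ofReal_norm] at h2
  rw [h1, ← h2, ← lintegral_const_mul]
  · refine lintegral_mono fun r => ?_
    have hr : 0 ≤ (r : ℝ) := nonneg_of_mem_spectrum hL r.2
    rw [one_pow, ENNReal.ofReal_one, one_mul]
    refine le_trans (le_of_eq ?_) (resolventIntegral_anti β hr (le_add_of_nonneg_right hε.le))
    rw [resolventIntegral_eq β (r := r + ε) (by positivity), mul_comm, ← Real.rpow_natCast,
      ← Real.rpow_mul (by positivity)]
    congr 3; push_cast; ring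
  · exact ((hc.pow 2).domRestrict.measurable).ennreal_ofReal

/-- A range criterion for self-adjoint operators. -/
theorem mem_range_of_norm_inner_le {B : H →L[𝕜] H} (hB : IsSelfAdjoint B) {f : H} {C : ℝ}
    (h : ∀ x, ‖⟪f, x⟫_𝕜‖ ≤ C * ‖B x‖) : f ∈ LinearMap.range B.toLinearMap := by
  have hwd : ∀ x y, B x = B y → ⟪f, x⟫_𝕜 = ⟪f, y⟫_𝕜 := by
    intro x y hxy
    have := h (x - y)
    rw [map_sub, hxy, sub_self, norm_zero, mul_zero, inner_sub_right] at this
    exact sub_eq_zero.mp (norm_le_zero_iff.mp this)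
  have hch : ∀ y : LinearMap.range B.toLinearMap, B y.2.choose = y := fun y => y.2.choose_spec
  -- The functional `B x ↦ ⟪f, x⟫` is well defined and bounded on `ran B`. Extended by Hahn–Banach
  -- and represented by a vector `g`, it gives `⟪g, B x⟫ = ⟪f, x⟫`, that is `B g = f`.
  let φ : StrongDual 𝕜 (LinearMap.range B.toLinearMap) := LinearMap.mkContinuous
    { toFun := fun y => ⟪f, y.2.choose⟫_𝕜
      map_add' := fun y z => by
        rw [← inner_add_right]
        exact hwd _ _ (by rw [map_add, hch, hch, hch]; rfl)
      map_smul' := fun c y => by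
        rw [RingHom.id_apply, smul_eq_mul, ← inner_smul_right]
        exact hwd _ _ (by rw [map_smul, hch, hch]; rfl) }
    C fun y => by
      refine (h _).trans_eq ?_
      rw [hch]; rfl
  obtain ⟨Φ, hΦ, -⟩ := exists_extension_norm_eq _ φ
  let g := (InnerProductSpace.toDual 𝕜 H).symm Φ
  refine ⟨g, ext_inner_right 𝕜 fun x => ?_⟩
  have h1 : ⟪g, B x⟫_𝕜 = Φ (B x) := InnerProductSpace.toDual_symm_apply
  have h2 : Φ (B x) = φ ⟨B x, x, rfl⟩ := hΦ ⟨B x, x, rfl⟩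
  have h3 : φ ⟨B x, x, rfl⟩ = ⟪f, x⟫_𝕜 := hwd _ _ (hch ⟨B x, x, rfl⟩)
  rw [← h3, ← h2, ← h1]
  have := ContinuousLinearMap.adjoint_inner_left B x g
  rwa [hB.adjoint_eq] at this

/-- Pair `f = (L + ε) ^ (β/2) (L + ε) ^ (-β/2) f` with `x`: the second factor applied to `f` is
bounded uniformly in `ε`, and the first, moved to `x`, tends to `L ^ (β/2) x` as `ε → 0`. -/
theorem mem_range_operatorPow {L : H →L[𝕜] H} (hL : 0 ≤ L) {β : ℝ} (hβ₀ : 0 < β) (hβ₁ : β < 1)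
    {f : H} (hf : resolventFormIntegral L β f < ∞) :
    f ∈ LinearMap.range (operatorPow L (β / 2)).toLinearMap := by
  have hsa : IsSelfAdjoint L := IsSelfAdjoint.of_nonneg hL
  have hJ : resolventFormIntegral L β f / resolventIntegral β 1 < ∞ :=
    ENNReal.div_lt_top hf.ne (resolventIntegral_pos β).ne'
  set D := (resolventFormIntegral L β f / resolventIntegral β 1).toReal with hD
  have hbd : ∀ ε : ℝ, 0 < ε → ‖cfc (fun r : ℝ => (r + ε) ^ (-(β / 2))) L f‖ ^ 2 ≤ D := by
    intro ε hε
    have h1 := norm_regularized_le hL β f hε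
    rw [mul_comm, ← ENNReal.le_div_iff_mul_le (Or.inl (resolventIntegral_pos β).ne')
      (Or.inl (resolventIntegral_lt_top hβ₀ hβ₁).ne)] at h1
    have h2 := ENNReal.toReal_mono hJ.ne h1
    simpa [D] using h2
  have hB : IsSelfAdjoint (operatorPow L (β / 2)) := by
    rw [operatorPow_eq_cfc hL]; exact cfc_predicate _ _
  refine mem_range_of_norm_inner_le hB (C := √D) fun x => ?_
  have hsmall : ∀ ε : ℝ, 0 < ε →
      ‖⟪f, x⟫_𝕜‖ ^ 2 ≤ D * (‖operatorPow L (β / 2) x‖ ^ 2 + ε ^ β * ‖x‖ ^ 2) := by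
    intro ε hε
    have hc := continuousOn_add_rpow_spectrum hL hε (-(β / 2))
    have hc' := continuousOn_add_rpow_spectrum hL hε (β / 2)
    have hf' : f = cfc (fun r : ℝ => (r + ε) ^ (β / 2)) L
        (cfc (fun r : ℝ => (r + ε) ^ (-(β / 2))) L f) := by
      rw [cfc_cfc_apply L hc' hc, cfc_congr (g := fun _ => 1), cfc_const_one ℝ L, one_apply_eq_self]
      intro r hr
      have := nonneg_of_mem_spectrum hL hr
      change (r + ε) ^ (β / 2) * (r + ε) ^ (-(β / 2)) = 1
      rw [← Real.rpow_add (by positivity), add_neg_cancel, Real.rpow_zero]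
    have hS : ‖cfc (fun r : ℝ => (r + ε) ^ (β / 2)) L x‖ ^ 2 ≤
        ‖operatorPow L (β / 2) x‖ ^ 2 + ε ^ β * ‖x‖ ^ 2 := by
      have hcr : ContinuousOn (fun r : ℝ => r ^ (β / 2)) (spectrum ℝ L) :=
        continuousOn_rpow_spectrum (by positivity)
      -- Subadditivity of `r ↦ r ^ β`, which uses `β ≤ 1`, read as an operator inequality.
      have hpos := re_inner_cfc_nonneg L
        (φ := fun r => ((r ^ (β / 2)) ^ 2 + ε ^ β) - ((r + ε) ^ (β / 2)) ^ 2) (fun r hr => by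
          have := nonneg_of_mem_spectrum hL hr
          rw [← Real.rpow_natCast, ← Real.rpow_natCast, ← Real.rpow_mul (by positivity),
            ← Real.rpow_mul (by positivity), sub_nonneg]
          push_cast
          rw [div_mul_cancel₀ _ two_ne_zero]
          exact Real.rpow_add_le_add_rpow this hε.le hβ₀.le hβ₁.le) x
      rw [cfc_sub (fun r => (r ^ (β / 2)) ^ 2 + ε ^ β) (fun r => ((r + ε) ^ (β / 2)) ^ 2) L
        ((hcr.pow 2).add continuousOn_const) (hc'.pow 2),
        cfc_add_const (ε ^ β) (fun r => (r ^ (β / 2)) ^ 2) L (hcr.pow 2),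
        algebraMap_operator, _root_.sub_apply, _root_.add_apply, _root_.smul_apply,
        one_apply_eq_self, inner_sub_left, inner_add_left, map_sub, map_add, inner_smul_left,
        RCLike.conj_ofReal, RCLike.re_ofReal_mul, inner_self_eq_norm_sq,
        re_inner_cfc_self_cfc L hc', re_inner_cfc_self_cfc L hcr] at hpos
      rw [operatorPow_eq_cfc hL]
      linarith
    rw [hf', inner_cfc_left]
    calc _ ≤ (‖cfc (fun r : ℝ => (r + ε) ^ (-(β / 2))) L f‖ *
          ‖cfc (fun r : ℝ => (r + ε) ^ (β / 2)) L x‖) ^ 2 := by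
          gcongr; exact norm_inner_le_norm _ _
      _ ≤ _ := by
        rw [mul_pow]
        exact mul_le_mul (hbd ε hε) hS (sq_nonneg _) ENNReal.toReal_nonneg
  have hlim : Filter.Tendsto
      (fun ε : ℝ => D * (‖operatorPow L (β / 2) x‖ ^ 2 + ε ^ β * ‖x‖ ^ 2))
      (nhdsWithin 0 (Set.Ioi 0)) (nhds (D * (‖operatorPow L (β / 2) x‖ ^ 2 + 0 ^ β * ‖x‖ ^ 2))) := by
    have : Continuous fun ε : ℝ => ε ^ β := Real.continuous_rpow_const hβ₀.le
    exact ((by fun_prop : Continuous fun ε : ℝ =>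
      D * (‖operatorPow L (β / 2) x‖ ^ 2 + ε ^ β * ‖x‖ ^ 2)).tendsto 0).mono_left
        nhdsWithin_le_nhds
  have h1 := ge_of_tendsto hlim (Filter.eventually_of_mem self_mem_nhdsWithin hsmall)
  rw [Real.zero_rpow hβ₀.ne', zero_mul, add_zero] at h1
  refine le_of_sq_le_sq ?_ (by positivity)
  rw [mul_pow, Real.sq_sqrt ENNReal.toReal_nonneg]
  exact h1

/-- The interpolation spaces of a positive operator are the real interpolation spaces. -/
theorem interpolationSpace_eq_realInterpolationSpace {β : ℝ} (hβ₀ : 0 < β) (hβ₁ : β < 1)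
    {L : H →L[𝕜] H} (hL : 0 ≤ L) :
    (interpolationSpace L β : Set H) =
      realInterpolationSpace (fun f : H => ‖f‖ₑ) (interpolationNorm L 1) β := by
  ext f
  constructor
  · rintro ⟨g, hg, rfl⟩
    refine ⟨⟨_, 0, (add_zero _).symm, by finiteness, ?_⟩, ?_⟩
    · refine lt_of_le_of_lt (iInf_le_of_le 0 (iInf_le_of_le (Submodule.zero_mem _)
        (iInf_le _ (map_zero _)))) (by simp)
    · have h := sq_realInterpolationNorm_le hL β (operatorPow L (β / 2) g)
      rw [resolventFormIntegral_operatorPow hL hβ₀ hg] at h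
      have hJ := resolventIntegral_lt_top hβ₀ hβ₁
      have : realInterpolationNorm (fun f : H => ‖f‖ₑ) (interpolationNorm L 1) β
          (operatorPow L (β / 2) g) ^ 2 < ∞ := h.trans_lt (by finiteness)
      simpa using this
  · rintro ⟨-, hf⟩
    rw [← range_operatorPow_eq_interpolationSpace hL hβ₀]
    exact mem_range_operatorPow hL hβ₀ hβ₁
      ((resolventFormIntegral_le hL β f).trans_lt (ENNReal.pow_lt_top hf))

theorem le_realInterpolationNorm_operatorPow {β : ℝ} (hβ₀ : 0 < β) (hβ₁ : β < 1)
    {L : H →L[𝕜] H} (hL : 0 ≤ L) {f : H} (hf : f ∈ (LinearMap.ker L.toLinearMap)ᗮ) :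
    ENNReal.ofReal √(resolventIntegral β 1).toReal * ‖f‖ₑ ≤ realInterpolationNorm
      (fun f : H => ‖f‖ₑ) (interpolationNorm L 1) β (operatorPow L (β / 2) f) := by
  have h := resolventFormIntegral_le hL β (operatorPow L (β / 2) f)
  rw [resolventFormIntegral_operatorPow hL hβ₀ hf] at h
  rw [← ENNReal.pow_le_pow_left_iff two_ne_zero, mul_pow,
    ← ENNReal.ofReal_pow (Real.sqrt_nonneg _), Real.sq_sqrt ENNReal.toReal_nonneg,
    ENNReal.ofReal_toReal (resolventIntegral_lt_top hβ₀ hβ₁).ne]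
  exact h

theorem realInterpolationNorm_operatorPow_le {β : ℝ} (hβ₀ : 0 < β) (hβ₁ : β < 1)
    {L : H →L[𝕜] H} (hL : 0 ≤ L) {f : H} (hf : f ∈ (LinearMap.ker L.toLinearMap)ᗮ) :
    realInterpolationNorm (fun f : H => ‖f‖ₑ) (interpolationNorm L 1) β (operatorPow L (β / 2) f) ≤
      ENNReal.ofReal √(2 * (resolventIntegral β 1).toReal) * ‖f‖ₑ := by
  have h := sq_realInterpolationNorm_le hL β (operatorPow L (β / 2) f)
  rw [resolventFormIntegral_operatorPow hL hβ₀ hf] at h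
  rw [← ENNReal.pow_le_pow_left_iff two_ne_zero, mul_pow,
    ← ENNReal.ofReal_pow (Real.sqrt_nonneg _), Real.sq_sqrt (by positivity),
    ENNReal.ofReal_mul zero_le_two, ENNReal.ofReal_ofNat,
    ENNReal.ofReal_toReal (resolventIntegral_lt_top hβ₀ hβ₁).ne, mul_assoc]
  exact h

end RealInterpolation

/-! ### Positivity of integrals by random sampling. -/

section Sampling

variable {X : Type*} [MeasurableSpace X] (ρ : Measure X) [IsProbabilityMeasure ρ]

theorem measurePreserving_eval_pair {ι : Type*} [Fintype ι] {i j : ι} (hij : i ≠ j) :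
    MeasurePreserving (fun x : ι → X => (x i, x j)) (Measure.pi fun _ => ρ) (ρ.prod ρ) := by
  refine ⟨by fun_prop, ?_⟩
  have h := (ProbabilityTheory.iIndepFun_pi (μ := fun _ : ι => ρ) (X := fun _ => (id : X → X))
    (fun _ => aemeasurable_id)).indepFun hij
  have h2 := (ProbabilityTheory.indepFun_iff_map_prod_eq_prod_map_map
    (measurable_pi_apply i).aemeasurable (measurable_pi_apply j).aemeasurable).mp h
  have h3 : ∀ k, (Measure.pi fun _ : ι => ρ).map (fun x => x k) = ρ := fun k =>
    (measurePreserving_eval (fun _ : ι => ρ) k).map_eq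
  rw [h3, h3] at h2
  exact h2

variable {ρ}

/-- A positive semidefinite kernel has a nonnegative integral. -/
theorem integral_nonneg_of_sum_nonneg {G : X × X → ℝ} (hG : Integrable G (ρ.prod ρ))
    (hD : Integrable (fun x => G (x, x)) ρ)
    (h : ∀ (n : ℕ) (x : Fin n → X), 0 ≤ ∑ i, ∑ j, G (x i, x j)) : 0 ≤ ∫ p, G p ∂ρ.prod ρ := by
  set I := ∫ p, G p ∂ρ.prod ρ with hI
  set D := ∫ x, G (x, x) ∂ρ with hD'
  have hint : ∀ (n : ℕ) (i j : Fin n),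
      Integrable (fun x : Fin n → X => G (x i, x j)) (Measure.pi fun _ => ρ) ∧
      ∫ x : Fin n → X, G (x i, x j) ∂(Measure.pi fun _ => ρ) = if i = j then D else I := by
    intro n i j
    split_ifs with hij
    · subst hij
      have hp := measurePreserving_eval (fun _ : Fin n => ρ) i
      refine ⟨hp.integrable_comp_of_integrable hD, ?_⟩
      have hm := integral_map (f := fun x => G (x, x)) hp.measurable.aemeasurable
        (by rw [hp.map_eq]; exact hD.aestronglyMeasurable)
      rw [hp.map_eq] at hm
      exact hm.symm
    · have hp := measurePreserving_eval_pair ρ hij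
      refine ⟨hp.integrable_comp_of_integrable hG, ?_⟩
      have hm := integral_map (f := G) hp.measurable.aemeasurable
        (by rw [hp.map_eq]; exact hG.aestronglyMeasurable)
      rw [hp.map_eq] at hm
      exact hm.symm
  -- The expected double sum over `n + 1` independent points has `n + 1` diagonal terms `D` and `n
  -- (n + 1)` terms `I`; divide by `n + 1`. Letting `n` grow rules out `I < 0`.
  have key : ∀ n : ℕ, 0 ≤ D + n * I := by
    intro n
    have h1 : 0 ≤ ∫ x : Fin (n + 1) → X, ∑ i, ∑ j, G (x i, x j) ∂(Measure.pi fun _ => ρ) :=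
      integral_nonneg (h (n + 1))
    rw [integral_finsetSum _ fun i _ => integrable_finsetSum _ fun j _ => (hint _ i j).1] at h1
    simp_rw [integral_finsetSum _ fun j _ => (hint _ _ j).1, (hint _ _ _).2] at h1
    have h2 : ∀ i : Fin (n + 1), ∑ j, (if i = j then D else I) = D + n * I := by
      intro i
      have : ∀ j, (if i = j then D else I) = (if i = j then D - I else 0) + I := by
        intro j; split_ifs <;> ring
      simp_rw [this]
      rw [Finset.sum_add_distrib]
      simp
      ring
    simp_rw [h2] at h1
    rw [Finset.sum_const, Finset.card_univ, Fintype.card_fin, nsmul_eq_mul] at h1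
    exact nonneg_of_mul_nonneg_right h1 (by positivity)
  by_contra hneg
  push Not at hneg
  obtain ⟨n, hn⟩ := exists_nat_gt (D / (-I))
  rw [div_lt_iff₀ (by linarith)] at hn
  have := key n
  linarith

/-- A positive semidefinite kernel has a nonnegative integral, whether or not its diagonal is
integrable. -/
theorem integral_nonneg_of_weighted_sum_nonneg {G : X × X → ℝ} (hGi : Integrable G (ρ.prod ρ))
    (hGm : Measurable fun x => G (x, x))
    (h : ∀ (n : ℕ) (x : Fin n → X) (c : Fin n → ℝ), 0 ≤ ∑ i, ∑ j, c i * c j * G (x i, x j)) :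
    0 ≤ ∫ p, G p ∂ρ.prod ρ := by
  -- Truncating to the points where the diagonal is at most `n` makes it integrable, and the
  -- indicators as weights preserve positivity. Dominated convergence removes the truncation.
  let S : ℕ → Set X := fun n => {x | ‖G (x, x)‖ ≤ n}
  have hS : ∀ n, MeasurableSet (S n) := fun n => measurableSet_le hGm.norm measurable_const
  let χ : ℕ → X → ℝ := fun n => (S n).indicator 1
  have hχm : ∀ n, Measurable (χ n) := fun n => measurable_one.indicator (hS n)
  have hχ : ∀ n x, ‖χ n x‖ ≤ 1 := fun n x => by
    simp only [χ, Set.indicator]; split_ifs <;> simp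
  have hχ2 : ∀ n (p : X × X), ‖χ n p.1 * χ n p.2 * G p‖ ≤ ‖G p‖ := fun n p => by
    rw [norm_mul, norm_mul]
    refine mul_le_of_le_one_left (norm_nonneg _) (mul_le_one₀ (hχ _ _) (norm_nonneg _) (hχ _ _))
  have hχm2 : ∀ n, AEStronglyMeasurable (fun p : X × X => χ n p.1 * χ n p.2 * G p) (ρ.prod ρ) :=
    fun n => (((hχm n).comp measurable_fst).mul
      ((hχm n).comp measurable_snd)).aestronglyMeasurable.mul hGi.aestronglyMeasurable
  have hpos : ∀ n, 0 ≤ ∫ p : X × X, χ n p.1 * χ n p.2 * G p ∂ρ.prod ρ := by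
    intro n
    refine integral_nonneg_of_sum_nonneg
      (hGi.mono (hχm2 n) (Filter.Eventually.of_forall (hχ2 n))) ?_
      fun m x => h m x fun i => χ n (x i)
    refine (integrable_const (n : ℝ)).mono'
      (((hχm n).mul (hχm n)).mul hGm).aestronglyMeasurable
      (Filter.Eventually.of_forall fun x => ?_)
    by_cases hx : x ∈ S n
    · simp only [χ, Set.indicator_of_mem hx, Pi.one_apply, one_mul]
      exact hx
    · simp only [χ, Set.indicator_of_notMem hx, zero_mul, norm_zero]
      positivity
  have hlim : Filter.Tendsto (fun n => ∫ p : X × X, χ n p.1 * χ n p.2 * G p ∂ρ.prod ρ)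
      Filter.atTop (nhds (∫ p, G p ∂ρ.prod ρ)) := by
    refine tendsto_integral_of_dominated_convergence (fun p => ‖G p‖) hχm2 hGi.norm
      (fun n => Filter.Eventually.of_forall (hχ2 n)) (Filter.Eventually.of_forall fun p => ?_)
    have hev : ∀ x : X, ∀ᶠ n in Filter.atTop, χ n x = 1 := by
      intro x
      obtain ⟨N, hN⟩ := exists_nat_gt ‖G (x, x)‖
      filter_upwards [Filter.eventually_ge_atTop N] with n hn
      have : x ∈ S n := hN.le.trans (by exact_mod_cast hn)
      simp [χ, Set.indicator_of_mem this]
    refine tendsto_const_nhds.congr' ?_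
    filter_upwards [hev p.1, hev p.2] with n h1 h2
    rw [h1, h2, one_mul, one_mul]
  exact ge_of_tendsto' hlim hpos

end Sampling

/-! ### Self-adjointness and positivity of the integral operator. -/

section KernelOperator
open scoped InnerProductSpace

variable {𝕜 X Y : Type*} [RCLike 𝕜] [NormedAddCommGroup Y] [InnerProductSpace 𝕜 Y]
  [CompleteSpace Y] [TopologicalSpace X] [PolishSpace X] [MeasurableSpace X] [BorelSpace X]
  [TopologicalSpace.SeparableSpace Y] {K : X → X → (Y →L[𝕜] Y)} {hK : IsOperatorKernel K}
  {ρX : Measure X} [IsProbabilityMeasure ρX]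

/-- Cauchy–Schwarz in `t`, then `a b ≤ a² + b²` in `x`. This licenses Fubini for the quadratic form.
-/
theorem IsOperatorKernel.IsMercer.integrable_inner (hM : hK.IsMercer) {κ : ℝ}
    (hκ : ∫⁻ x, ∫⁻ x', ‖K x x'‖ₑ ^ 2 ∂ρX ∂ρX ≤ ENNReal.ofReal (κ ^ 2)) (f g : Lp Y 2 ρX) :
    Integrable (fun p : X × X => ⟪g p.1, K p.1 p.2 (f p.2)⟫_𝕜) (ρX.prod ρX) := by
  have hm : StronglyMeasurable fun p : X × X => ⟪g p.1, K p.1 p.2 (f p.2)⟫_𝕜 :=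
    ((Lp.stronglyMeasurable g).comp_measurable measurable_fst).inner
      (hM.stronglyMeasurable_comp (Lp.stronglyMeasurable f))
  refine ⟨hm.aestronglyMeasurable, ?_⟩
  rw [HasFiniteIntegral, lintegral_prod _ hm.enorm.aemeasurable]
  have hg : ∫⁻ x, ‖g x‖ₑ ^ 2 ∂ρX < ∞ := by
    have := (Lp.memLp g).eLpNorm_lt_top
    rw [eLpNorm_lt_top_iff_lintegral_rpow_enorm_lt_top (by norm_num) (by norm_num)] at this
    simpa using this
  calc ∫⁻ x, ∫⁻ t, ‖⟪g x, K x t (f t)⟫_𝕜‖ₑ ∂ρX ∂ρX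
      ≤ ∫⁻ x, (‖g x‖ₑ ^ 2 + ∫⁻ t, ‖K x t‖ₑ ^ 2 ∂ρX) * ‖f‖ₑ ∂ρX := by
        refine lintegral_mono fun x => ?_
        calc ∫⁻ t, ‖⟪g x, K x t (f t)⟫_𝕜‖ₑ ∂ρX
            ≤ ∫⁻ t, ‖g x‖ₑ * ‖K x t (f t)‖ₑ ∂ρX := by
              refine lintegral_mono fun t => ?_
              rw [← ofReal_norm, ← ofReal_norm (g x), ← ofReal_norm (K x t (f t)),
                ← ENNReal.ofReal_mul (norm_nonneg _)]
              exact ENNReal.ofReal_le_ofReal (norm_inner_le_norm _ _)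
          _ = ‖g x‖ₑ * ∫⁻ t, ‖K x t (f t)‖ₑ ∂ρX := lintegral_const_mul' _ _ (by finiteness)
          _ ≤ ‖g x‖ₑ * ((∫⁻ t, ‖K x t‖ₑ ^ 2 ∂ρX) ^ (1 / 2 : ℝ) * ‖f‖ₑ) := by
              gcongr; exact hM.lintegral_enorm_le f x
          _ ≤ _ := by
              rw [← mul_assoc]
              gcongr
              set b := (∫⁻ t, ‖K x t‖ₑ ^ 2 ∂ρX) ^ (1 / 2 : ℝ) with hb
              have hb2 : ∫⁻ t, ‖K x t‖ₑ ^ 2 ∂ρX = b ^ 2 := by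
                rw [hb, ← ENNReal.rpow_natCast, ← ENNReal.rpow_mul]; norm_num
              rw [hb2]
              rcases le_total ‖g x‖ₑ b with h | h
              · calc ‖g x‖ₑ * b ≤ b * b := by gcongr
                  _ ≤ _ := by rw [← pow_two]; exact le_add_self
              · calc ‖g x‖ₑ * b ≤ ‖g x‖ₑ * ‖g x‖ₑ := by gcongr
                  _ ≤ _ := by rw [← pow_two]; exact le_self_add
    _ = ((∫⁻ x, ‖g x‖ₑ ^ 2 ∂ρX) + ∫⁻ x, ∫⁻ t, ‖K x t‖ₑ ^ 2 ∂ρX ∂ρX) * ‖f‖ₑ := by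
        rw [lintegral_mul_const' _ _ (by finiteness), lintegral_add_left']
        exact (Lp.aestronglyMeasurable g).enorm.pow_const 2
    _ < ∞ := ENNReal.mul_lt_top
        (ENNReal.add_lt_top.mpr ⟨hg, hκ.trans_lt ENNReal.ofReal_lt_top⟩) (by finiteness)

theorem inner_kernelIntegralOperator (hM : hK.IsMercer) {κ : ℝ}
    (hκ : ∫⁻ x, ∫⁻ x', ‖K x x'‖ₑ ^ 2 ∂ρX ∂ρX ≤ ENNReal.ofReal (κ ^ 2)) (f g : Lp Y 2 ρX) :
    ⟪g, kernelIntegralOperator hM hκ f⟫_𝕜 = ∫ x, ∫ t, ⟪g x, K x t (f t)⟫_𝕜 ∂ρX ∂ρX := by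
  let _ : NormedSpace ℝ Y := NormedSpace.restrictScalars ℝ 𝕜 Y
  rw [L2.inner_def]
  refine integral_congr_ae ?_
  filter_upwards [kernelIntegralOperator_ae_eq hM hκ f, hM.ae_integrable hκ] with x hx hi
  rw [hx, kernelIntegral, ← integral_inner (hi f)]

theorem isSymmetric_kernelIntegralOperator (hM : hK.IsMercer) {κ : ℝ}
    (hκ : ∫⁻ x, ∫⁻ x', ‖K x x'‖ₑ ^ 2 ∂ρX ∂ρX ≤ ENNReal.ofReal (κ ^ 2)) :
    (kernelIntegralOperator hM hκ : Lp Y 2 ρX →L[𝕜] Lp Y 2 ρX).toLinearMap.IsSymmetric := by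
  intro g f
  change ⟪kernelIntegralOperator hM hκ g, f⟫_𝕜 = ⟪g, kernelIntegralOperator hM hκ f⟫_𝕜
  rw [← inner_conj_symm, inner_kernelIntegralOperator, inner_kernelIntegralOperator,
    integral_integral_swap (hM.integrable_inner hκ g f), ← integral_conj]
  refine integral_congr_ae (Filter.Eventually.of_forall fun x => ?_)
  simp only
  rw [← integral_conj]
  refine integral_congr_ae (Filter.Eventually.of_forall fun t => ?_)
  simp only
  rw [inner_conj_symm, hK.inner_swap]

/-- The scalar kernel `re ⟪f x, K x t (f t)⟫` is positive semidefinite: insert `y i = c i • f (x i)`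
in the positivity of `K`. The bound on `K` controls only the double integral, so the sampling lemma
without integrable diagonal is the one needed. -/
theorem re_inner_kernelIntegralOperator_nonneg (hM : hK.IsMercer) {κ : ℝ}
    (hκ : ∫⁻ x, ∫⁻ x', ‖K x x'‖ₑ ^ 2 ∂ρX ∂ρX ≤ ENNReal.ofReal (κ ^ 2)) (f : Lp Y 2 ρX) :
    0 ≤ RCLike.re ⟪f, kernelIntegralOperator hM hκ f⟫_𝕜 := by
  have hI := hM.integrable_inner hκ f f
  rw [inner_kernelIntegralOperator, ← integral_prod _ hI, ← integral_re hI]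
  let G : X × X → ℝ := fun p => RCLike.re ⟪f p.1, K p.1 p.2 (f p.2)⟫_𝕜
  have hGi : Integrable G (ρX.prod ρX) := hI.re
  have hdiag : Measurable fun x : X => (x, x) := measurable_id.prodMk measurable_id
  have hGm : Measurable fun x => G (x, x) :=
    RCLike.measurable_re.comp (((Lp.stronglyMeasurable f).inner
      ((hM.stronglyMeasurable_comp (Lp.stronglyMeasurable f)).comp_measurable hdiag)).measurable)
  refine integral_nonneg_of_weighted_sum_nonneg hGi hGm fun n x c => ?_
  have h := hK.nonneg n x fun i => (c i : 𝕜) • f (x i)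
  simp only [map_sum] at h
  convert h using 3 with i _ j _
  rw [map_smul, inner_smul_left, inner_smul_right, RCLike.conj_ofReal, RCLike.re_ofReal_mul,
    RCLike.re_ofReal_mul, inner_re_symm]
  ring

theorem kernelIntegralOperator_nonneg (hM : hK.IsMercer) {κ : ℝ}
    (hκ : ∫⁻ x, ∫⁻ x', ‖K x x'‖ₑ ^ 2 ∂ρX ∂ρX ≤ ENNReal.ofReal (κ ^ 2)) :
    0 ≤ (kernelIntegralOperator hM hκ : Lp Y 2 ρX →L[𝕜] Lp Y 2 ρX) := by
  rw [ContinuousLinearMap.nonneg_iff_isPositive]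
  refine ⟨isSymmetric_kernelIntegralOperator hM hκ, fun f => ?_⟩
  rw [ContinuousLinearMap.reApplyInnerSelf, inner_re_symm]
  exact re_inner_kernelIntegralOperator_nonneg hM hκ f

end KernelOperator

theorem theorem1 (β : ℝ) (hβ₀ : 0 < β) (hβ₁ : β < 1) :
    ∃ c C : ℝ, 0 < c ∧ 0 < C ∧
      ∀ (𝕜 : Type*) [RCLike 𝕜]
        (X : Type*) [TopologicalSpace X] [PolishSpace X] [MeasurableSpace X] [BorelSpace X]
        (Y : Type*) [NormedAddCommGroup Y] [InnerProductSpace 𝕜 Y] [CompleteSpace Y]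
        [TopologicalSpace.SeparableSpace Y]
        (ρX : Measure X) [IsProbabilityMeasure ρX] [ρX.IsOpenPosMeasure]
        (K : X → X → (Y →L[𝕜] Y)) (hK : IsOperatorKernel K) (hM : hK.IsMercer) (κ : ℝ)
        (hκ : ∫⁻ x, ∫⁻ x', ‖K x x'‖ₑ ^ 2 ∂ρX ∂ρX ≤ ENNReal.ofReal (κ ^ 2)),
        let L : Lp Y 2 ρX →L[𝕜] Lp Y 2 ρX := kernelIntegralOperator hM hκ
        let N₁ : Lp Y 2 ρX → ℝ≥0∞ := fun f => ‖f‖ₑ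
        let N₂ : Lp Y 2 ρX → ℝ≥0∞ := interpolationNorm L 1
        LinearMap.range (operatorPow L (β / 2)).toLinearMap = interpolationSpace L β ∧
        (interpolationSpace L β : Set (Lp Y 2 ρX)) = realInterpolationSpace N₁ N₂ β ∧
        ∀ f ∈ (LinearMap.ker L.toLinearMap)ᗮ,
          interpolationNorm L β (operatorPow L (β / 2) f) = ‖f‖ₑ ∧
          ENNReal.ofReal c * ‖f‖ₑ ≤ realInterpolationNorm N₁ N₂ β (operatorPow L (β / 2) f) ∧
          realInterpolationNorm N₁ N₂ β (operatorPow L (β / 2) f) ≤ ENNReal.ofReal C * ‖f‖ₑ := by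
  have hJ := ENNReal.toReal_pos (resolventIntegral_pos β).ne' (resolventIntegral_lt_top hβ₀ hβ₁).ne
  -- The constants are `c = √J(1)` and `C = √(2 J(1))`; `J(1)` depends on `β` alone.
  refine ⟨_, _, Real.sqrt_pos.mpr hJ, Real.sqrt_pos.mpr (mul_pos two_pos hJ), ?_⟩
  intro 𝕜 _ X _ _ _ _ Y _ _ _ _ ρX _ _ K hK hM κ hκ L N₁ N₂
  have hL : 0 ≤ L := kernelIntegralOperator_nonneg hM hκ
  exact ⟨range_operatorPow_eq_interpolationSpace hL hβ₀,
    interpolationSpace_eq_realInterpolationSpace hβ₀ hβ₁ hL, fun f hf =>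
    ⟨interpolationNorm_operatorPow hL hβ₀ hf, le_realInterpolationNorm_operatorPow hβ₀ hβ₁ hL hf,
      realInterpolationNorm_operatorPow_le hβ₀ hβ₁ hL hf⟩⟩
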